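/- Let $n\ge 1$ and $p\in(0,1]$. Run Quicksort on $n$ distinct elements presented in uniformly random order, as follows: the first element of the list is the pivot; every other element is compared once with the pivot, and is put in the left sublist if the comparison reports it smaller than the pivot and in the right sublist otherwise; the algorithm is then applied recursively to the two sublists, and the output is the sorted left sublist, followed by the pivot, followed by the sorted right sublist. Each comparison of two elements gives the wrong answer with probability $p$, independently of all the other comparisons and of the input order. Let $I(n,p)$ be the number of inversions of the output sequence $y$, that is, the number of pairs $i<j$ with $y_i>y_j$, and put $X_{n,p}=I(n,p)/(n^2p)$. The equation $$X\overset{\text{law}}{=}U^2X+(1-U)^2\widetilde X+\frac{U^2+(1-U)^2}{2},$$ in which $U$ is uniformly distributed on $[0,1]$, $\widetilde X$ has the same law as $X$, and $X,\widetilde X,U$ are independent, has a solution $X$ with finite mean, and the law of such a solution is unique. If $p\to0$ and $np\to+\infty$ (that is, along the filter on $\mathbb N\times[0,1]$ generated by these two conditions, without assuming that $p$ is a function of $n$), then $X_{n,p}$ converges to $X$ in distribution, and also in the Wasserstein metric $d_1(\mu,\nu)=\inf E|Y-Z|$, the infimum being over all couplings $(Y,Z)$ of $\mu$ and $\nu$.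 Moreover $X$ has a finite second moment, $E X=1$ and $\operatorname{Var}X=\frac1{12}$. -/

import Mathlib

open MeasureTheory ProbabilityTheory Filter Topology
open scoped ENNReal

noncomputable section

namespace NoisyQuicksort

/-- The error indicator of one element comparison: `true` (an error) with probability `p`,
`false` with probability `1 - p`. -/
def errorCoin (p : unitInterval) : PMF Bool :=
  PMF.ofFintype (fun b => if b then ENNReal.ofReal p else ENNReal.ofReal (1 - p)) (by
    have h0 : (0 : ℝ) ≤ p := p.2.1
    have h1 : (0 : ℝ) ≤ 1 - p := by linarith [p.2.2]
    simp [← ENNReal.ofReal_add h0 h1])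

/-- Every element of `l` is compared once with the pivot `a`, and each comparison is wrong with
probability `p`, independently of the others. The result is the law of the pair (left sublist,
right sublist): `b` goes to the left if the comparison reports `b < a`, that is, if `b < a` and
there is no error, or if `¬ b < a` and there is an error. -/
def partition {α : Type*} [LinearOrder α] (p : unitInterval) (a : α) : List α → PMF (List α × List α)
  | [] => PMF.pure ([], [])
  | b :: l =>
      (errorCoin p).bind fun e =>
        (partition p a l).bind fun s =>
          PMF.pure (if xor (decide (b < a)) e then (b :: s.1, s.2) else (s.1, b :: s.2))

theorem length_of_mem_support_partition {α : Type*} [LinearOrder α] (p : unitInterval) (a : α) :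
    ∀ (l : List α) (s : List α × List α), s ∈ (partition p a l).support →
      s.1.length + s.2.length = l.length
  | [], s, h => by
      simp only [partition, PMF.mem_support_pure_iff] at h
      simp [h]
  | b :: l, s, h => by
      simp only [partition, PMF.mem_support_bind_iff, PMF.mem_support_pure_iff] at h
      obtain ⟨e, -, t, ht, rfl⟩ := h
      have := length_of_mem_support_partition p a l t ht
      split_ifs <;> simp <;> omega

/-- Quicksort with comparison errors: the law of the output list on input `l`. The pivot is the
first element, the rest of the list is split by faulty comparisons with the pivot, and the two
sublists are then sorted independently by the same algorithm. (`bindOnSupport` is the monadic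
`bind` that also hands over the fact that `s` is a possible outcome; it is used for termination
only.) -/
def quicksort {α : Type*} [LinearOrder α] (p : unitInterval) : List α → PMF (List α)
  | [] => PMF.pure []
  | a :: l =>
      (partition p a l).bindOnSupport fun s _hs =>
        (quicksort p s.1).bind fun x =>
          (quicksort p s.2).bind fun y =>
            PMF.pure (x ++ a :: y)
  termination_by l => l.length
  decreasing_by
    all_goals
      have := length_of_mem_support_partition p a l s _hs
      simp only [List.length_cons]
      omega

/-- The number of inversions of a list: the number of pairs of positions `i < j` whose entries
are in the wrong order. -/
def inversions {α : Type*} [LinearOrder α] (y : List α) : ℕ :=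
  (Finset.univ.filter fun ij : Fin y.length × Fin y.length =>
    ij.1 < ij.2 ∧ y.get ij.2 < y.get ij.1).card

/-- The law of `I(n, p)`, the number of inversions in the output of Quicksort with error
probability `p`, on `n` distinct elements presented in uniformly random order. -/
def inversionLaw (n : ℕ) (p : unitInterval) : PMF ℕ :=
  (PMF.uniformOfFintype (Equiv.Perm (Fin n))).bind fun σ =>
    (quicksort p (List.ofFn σ)).map inversions

/-- The law of `X_{n,p} = I(n, p) / (n ^ 2 * p)`. -/
def normalizedLaw (n : ℕ) (p : unitInterval) : ProbabilityMeasure ℝ :=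
  ⟨((inversionLaw n p).map fun k : ℕ => (k : ℝ) / ((n : ℝ) ^ 2 * (p : ℝ))).toMeasure,
    inferInstance⟩

/-- The filter on `ℕ × [0, 1]` that expresses `p → 0` and `n p → ∞`. -/
def slowFilter : Filter (ℕ × unitInterval) :=
  comap (fun x : ℕ × unitInterval => (x.2 : ℝ)) (𝓝 0) ⊓ comap (fun x : ℕ × unitInterval => (x.1 : ℝ) * (x.2 : ℝ)) atTop

/-- The uniform distribution on `[0, 1]`. -/
def uniform01 : Measure ℝ := volume.restrict (Set.Icc 0 1)

/-- `μ` is the law of a random variable `X` that satisfies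
`X = U ^ 2 X + (1 - U) ^ 2 X' + (U ^ 2 + (1 - U) ^ 2) / 2` in law, where `X'` is a copy of `X`,
`U` is uniform on `[0, 1]`, and `X, X', U` are independent. -/
def SolvesEquation (μ : Measure ℝ) : Prop :=
  (μ.prod (μ.prod uniform01)).map
    (fun z : ℝ × ℝ × ℝ =>
      z.2.2 ^ 2 * z.1 + (1 - z.2.2) ^ 2 * z.2.1 + (z.2.2 ^ 2 + (1 - z.2.2) ^ 2) / 2) = μ

/-- The Wasserstein distance `d₁(μ, ν)`: the infimum of `E |X - Y|` over all couplings of `μ`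
and `ν`. -/
def wasserstein (μ ν : Measure ℝ) : ℝ≥0∞ :=
  ⨅ (γ : Measure (ℝ × ℝ)) (_ : γ.map Prod.fst = μ ∧ γ.map Prod.snd = ν),
    ∫⁻ z, ENNReal.ofReal |z.1 - z.2| ∂γ

end NoisyQuicksort

end

/-!
The pivot of a uniformly random list of length `n` has a uniform rank `a`, and given the pivot and
the set of elements whose comparison goes wrong, the two sublists are independent and uniformly
random (`inversionLaw_succ`; the independence comes from averaging over the permutations that
preserve the two sets, `bind_uniform_filter`). Hence
`I(n) = I(l) + I'(r) + T`, where `l` and `r` are the sizes of the sublists and `T`, the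
`stageCost`, counts the inverted pairs separated at this stage.

To first order, an erroneous element `b` creates `|b - a|` inversions, so that `T` is a sum of
independent terms with mean `p * ∑ |b - a|`, up to the pairs of two errors. Its variance is at most
`n ^ 3 * p`, which is small against `(n ^ 2 * p) ^ 2` when `n * p` is large
(`mean_abs_stageCost_le`), and the sizes of the sublists differ from `a` and `n - 1 - a` by at most
the number of errors. After division by `n ^ 2 * p` the recursion turns into the limiting equation,
with `U` in the `a`-th of `n` equal intervals.

For the convergence, couplings of `I(m) / p` with `m ^ 2 X` for `m < n` are put together to one for
`n` (`hasCoupling_step`). The costs `D` satisfy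
`D n ≤ E (D l + D r) + error`, and `E (l ^ 2 + r ^ 2) ≤ 3 / 4 * n ^ 2` for small `p`, so a bound of
order `n ^ 2` reproduces itself. The error is always `O(n ^ 2)`, and is `O((p + δ) n ^ 2)` once
`n ≥ 1 / (δ ^ 2 p)`; for shorter lists the crude bound `60 n ^ 2` is at most a linear term
`60 n / (δ ^ 2 p)`, which the recursion does not increase since `l + r < n`. This gives
`d₁ ≤ 4 (15 p + δ) + 60 / (δ ^ 2 n p)` (`wasserstein_normalizedLaw_le`).

The solution of the limiting equation is a sum over the nodes of the infinite binary tree with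
independent uniform variables at the nodes, the increasing limit of the iterates from `0`, whose
first two moments stay bounded (`exists_solution`). It is unique because the equation contracts the
cost of couplings by `2 / 3`. Its mean and variance are read off the equation.
-/

noncomputable section

namespace NoisyQuicksort

/-! ### Inversions, and Quicksort on a fixed list -/

theorem countP_eq_sum_fin {α : Type*} (P : α → Prop) [DecidablePred P] (l : List α) :
    l.countP (fun x => P x) = ∑ i : Fin l.length, if P (l.get i) then 1 else 0 := by
  induction l with
  | nil => simp
  | cons a l ih =>
    rw [List.countP_cons, ih, add_comm]
    simp only [decide_eq_true_eq]
    exact (Fin.sum_univ_succ fun i : Fin (l.length + 1) =>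
      if P ((a :: l).get i) then 1 else 0).symm

section Inversions

variable {α : Type*} [LinearOrder α]

/-- Inversions of a list, counted recursively: the entries after the head that are smaller than
the head, and the inversions of the tail. -/
def inversionCount : List α → ℕ
  | [] => 0
  | a :: l => l.countP (· < a) + inversionCount l

/-- The number of pairs `(b, c)` with `b` in `s`, `c` in `t` and `c < b`. -/
def crossCount (s t : List α) : ℕ := (s.map fun b => t.countP (· < b)).sum

/-- The inversions which the separation into `s`, `a`, `t` makes unavoidable: the inverted pairs of
`s ++ a :: t` whose entries do not lie both in `s` or both in `t`. -/
def splitCost (a : α) (s t : List α) : ℕ := crossCount s (a :: t) + t.countP (· < a)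

theorem inversions_eq_inversionCount (y : List α) : inversions y = inversionCount y := by
  have key : ∀ y : List α, inversions y = ∑ i : Fin y.length, ∑ j : Fin y.length,
      if i < j ∧ y.get j < y.get i then 1 else 0 := by
    intro y
    rw [inversions, Finset.card_filter, Fintype.sum_prod_type]
  induction y with
  | nil => simp [inversions, inversionCount]
  | cons a l ih =>
    rw [key] at ih ⊢
    rw [inversionCount, ← ih, countP_eq_sum_fin]
    simp [Fin.sum_univ_succ, -Finset.sum_boole]

theorem crossCount_cons_left (b : α) (s t : List α) :
    crossCount (b :: s) t = t.countP (· < b) + crossCount s t := by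
  simp [crossCount]

theorem inversionCount_append (s t : List α) :
    inversionCount (s ++ t) = inversionCount s + inversionCount t + crossCount s t := by
  induction s with
  | nil => simp [inversionCount, crossCount]
  | cons b s ih =>
    rw [List.cons_append, inversionCount, inversionCount, ih, crossCount_cons_left,
      List.countP_append]
    omega

theorem inversions_append_cons (s : List α) (a : α) (t : List α) :
    inversions (s ++ a :: t) = inversions s + inversions t + splitCost a s t := by
  simp only [inversions_eq_inversionCount, inversionCount_append, inversionCount, splitCost]
  omega

theorem splitCost_perm (a : α) {s s' t t' : List α} (hs : s.Perm s') (ht : t.Perm t') :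
    splitCost a s t = splitCost a s' t' := by
  have h : ∀ b, (a :: t).countP (· < b) = (a :: t').countP (· < b) := fun b =>
    (ht.cons a).countP_eq _
  simp only [splitCost, crossCount, h]
  rw [(hs.map _).sum_eq, ht.countP_eq]

theorem splitCost_map {β : Type*} [LinearOrder β] {f : α → β} (hf : StrictMono f) (a : α)
    (s t : List α) : splitCost (f a) (s.map f) (t.map f) = splitCost a s t := by
  simp only [splitCost, crossCount, ← List.map_cons, List.map_map, List.countP_map,
    Function.comp_def, hf.lt_iff_lt]

end Inversions

section Law

variable {α : Type*} [LinearOrder α] (p : unitInterval)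

theorem bind_congr_of_mem_support {α β : Type*} (P : PMF α) {f g : α → PMF β}
    (h : ∀ a ∈ P.support, f a = g a) : P.bind f = P.bind g := by
  ext b
  rw [PMF.bind_apply, PMF.bind_apply]
  refine tsum_congr fun a => ?_
  by_cases ha : a ∈ P.support
  · rw [h a ha]
  · rw [(PMF.apply_eq_zero_iff _ _).2 ha, zero_mul, zero_mul]

theorem perm_of_mem_support_partition (a : α) :
    ∀ (l : List α) (s : List α × List α), s ∈ (partition p a l).support → (s.1 ++ s.2).Perm l
  | [], s, h => by
      simp only [partition, PMF.mem_support_pure_iff] at h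
      simp [h]
  | b :: l, s, h => by
      simp only [partition, PMF.mem_support_bind_iff, PMF.mem_support_pure_iff] at h
      obtain ⟨e, -, t, ht, rfl⟩ := h
      have := perm_of_mem_support_partition a l t ht
      split_ifs
      · exact this.cons b
      · exact List.perm_middle.trans (this.cons b)

theorem quicksort_cons (a : α) (l : List α) :
    quicksort p (a :: l) = (partition p a l).bind fun s =>
      (quicksort p s.1).bind fun x => (quicksort p s.2).bind fun y => PMF.pure (x ++ a :: y) := by
  rw [quicksort, PMF.bindOnSupport_eq_bind]

theorem perm_of_mem_support_quicksort (n : ℕ) : ∀ l : List α, l.length ≤ n →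
    ∀ x ∈ (quicksort p l).support, x.Perm l := by
  induction n with
  | zero =>
    intro l hl x hx
    obtain rfl := List.length_eq_zero_iff.1 (Nat.le_zero.1 hl)
    simp only [quicksort, PMF.mem_support_pure_iff] at hx
    simp [hx]
  | succ n ih =>
    intro l hl x hx
    cases l with
    | nil =>
      simp only [quicksort, PMF.mem_support_pure_iff] at hx
      simp [hx]
    | cons a l =>
      rw [quicksort_cons] at hx
      simp only [PMF.mem_support_bind_iff, PMF.mem_support_pure_iff] at hx
      obtain ⟨s, hs, x', hx', y', hy', rfl⟩ := hx
      have hlen := length_of_mem_support_partition p a l s hs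
      simp only [List.length_cons] at hl
      have h1 := ih s.1 (by omega) x' hx'
      have h2 := ih s.2 (by omega) y' hy'
      exact List.perm_middle.trans
        (((h1.append h2).trans (perm_of_mem_support_partition p a l s hs)).cons a)

/-- The law of the number of inversions in the output of Quicksort on input `l`. -/
def inversionLawOf (l : List α) : PMF ℕ := (quicksort p l).map inversions

theorem inversionLawOf_nil : inversionLawOf p ([] : List α) = PMF.pure 0 := by
  simp [inversionLawOf, quicksort, PMF.pure_map, inversions_eq_inversionCount, inversionCount]

/-- The output is a permutation of the input, so the cost of the first stage depends on the two
sublists only. -/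
theorem inversionLawOf_cons (a : α) (l : List α) :
    inversionLawOf p (a :: l) = (partition p a l).bind fun s =>
      (inversionLawOf p s.1).bind fun i => (inversionLawOf p s.2).bind fun j =>
        PMF.pure (i + j + splitCost a s.1 s.2) := by
  simp only [inversionLawOf, quicksort_cons, PMF.map_bind, PMF.bind_map, PMF.pure_map]
  refine congrArg _ (funext fun s => ?_)
  refine bind_congr_of_mem_support _ fun x hx => bind_congr_of_mem_support _ fun y hy => ?_
  simp only [Function.comp_def]
  rw [inversions_append_cons, splitCost_perm a (perm_of_mem_support_quicksort p _ _ le_rfl x hx)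
    (perm_of_mem_support_quicksort p _ _ le_rfl y hy)]

theorem partition_map {β : Type*} [LinearOrder β] {f : α → β} (hf : StrictMono f) (a : α)
    (l : List α) : partition p (f a) (l.map f) =
      (partition p a l).map (Prod.map (List.map f) (List.map f)) := by
  induction l with
  | nil => simp [partition, PMF.pure_map]
  | cons b l ih =>
    simp only [List.map_cons, partition, ih, PMF.map_bind, PMF.bind_map, PMF.pure_map,
      hf.lt_iff_lt, Function.comp_def, apply_ite (Prod.map (List.map f) (List.map f)),
      Prod.map_apply, Prod.map_fst, Prod.map_snd]

theorem inversionLawOf_map_aux {β : Type*} [LinearOrder β] {f : α → β} (hf : StrictMono f)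
    (n : ℕ) : ∀ l : List α, l.length ≤ n → inversionLawOf p (l.map f) = inversionLawOf p l := by
  induction n with
  | zero =>
    intro l hl
    obtain rfl := List.length_eq_zero_iff.1 (Nat.le_zero.1 hl)
    simp [inversionLawOf_nil]
  | succ n ih =>
    intro l hl
    cases l with
    | nil => simp [inversionLawOf_nil]
    | cons a l =>
      rw [List.map_cons, inversionLawOf_cons, inversionLawOf_cons, partition_map p hf, PMF.bind_map]
      refine bind_congr_of_mem_support _ fun s hs => ?_
      have hlen := length_of_mem_support_partition p a l s hs
      simp only [List.length_cons] at hl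
      simp only [Function.comp_def, Prod.map_fst, Prod.map_snd, splitCost_map hf,
        ih s.1 (by omega), ih s.2 (by omega)]

theorem inversionLawOf_map {β : Type*} [LinearOrder β] {f : α → β} (hf : StrictMono f)
    (l : List α) : inversionLawOf p (l.map f) = inversionLawOf p l :=
  inversionLawOf_map_aux p hf _ l le_rfl

end Law

section Coins

variable {ι : Type*} [Fintype ι] [DecidableEq ι] (p : unitInterval)

/-- Independent error indicators, one for each element of `ι`. -/
def coins (ι : Type*) [Fintype ι] [DecidableEq ι] (p : unitInterval) : PMF (ι → Bool) :=
  PMF.ofFintype (fun e => ∏ i, errorCoin p (e i)) (by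
    have h := (Finset.prod_univ_sum (fun _ : ι => (Finset.univ : Finset Bool))
      (fun _ b => errorCoin p b)).symm
    rw [Fintype.piFinset_univ] at h
    rw [h]
    refine Finset.prod_eq_one fun i _ => ?_
    rw [← tsum_fintype (L := .unconditional _), PMF.tsum_coe])

/-- Resampling one of the coins does not change their joint law. -/
theorem bind_coins_update (b : ι) :
    (errorCoin p).bind (fun e₀ => (coins ι p).map fun e => Function.update e b e₀) =
      coins ι p := by
  ext e'
  simp only [PMF.bind_apply, PMF.map_apply, tsum_fintype]
  have hsum : errorCoin p true + errorCoin p false = 1 := by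
    rw [← PMF.tsum_coe (errorCoin p), tsum_fintype, Fintype.sum_bool]
  have hval : ∀ e : ι → Bool, coins ι p e = ∏ i, errorCoin p (e i) := fun e => rfl
  have hprod : ∀ t, coins ι p (Function.update e' b t) =
      errorCoin p t * ∏ i ∈ Finset.univ.erase b, errorCoin p (e' i) := by
    intro t
    rw [hval, ← Finset.mul_prod_erase _ _ (Finset.mem_univ b), Function.update_self]
    congr 1
    refine Finset.prod_congr rfl fun i hi => ?_
    rw [Function.update_of_ne (Finset.ne_of_mem_erase hi)]
  have hinner : ∀ e₀, (∑ e, if e' = Function.update e b e₀ then coins ι p e else 0) =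
      if e₀ = e' b then ∏ i ∈ Finset.univ.erase b, errorCoin p (e' i) else 0 := by
    intro e₀
    split_ifs with h0
    · subst h0
      have hset : (Finset.univ.filter fun e : ι → Bool => e' = Function.update e b (e' b)) =
          {Function.update e' b true, Function.update e' b false} := by
        ext e
        simp only [Finset.mem_filter, Finset.mem_univ, true_and, Finset.mem_insert,
          Finset.mem_singleton]
        constructor
        · intro h
          have : e = Function.update e' b (e b) := by
            rw [h]; simp
          cases hb : e b
          · right; rw [this, hb]
          · left; rw [this, hb]
        · rintro (rfl | rfl) <;> simp
      rw [← Finset.sum_filter, hset, Finset.sum_pair, hprod, hprod, ← add_mul, hsum, one_mul]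
      intro h
      have := congrFun h b
      simp at this
    · refine Finset.sum_eq_zero fun e _ => if_neg ?_
      rintro rfl
      simp at h0
  trans ∑ e₀, errorCoin p e₀ *
    if e₀ = e' b then ∏ i ∈ Finset.univ.erase b, errorCoin p (e' i) else 0
  · refine Finset.sum_congr rfl fun e₀ _ => ?_
    rw [← hinner e₀]
    congr!
  simp only [mul_ite, mul_zero, Finset.sum_ite_eq', Finset.mem_univ, if_true]
  rw [hval, ← Finset.mul_prod_erase _ _ (Finset.mem_univ b)]

end Coins

/-- Whether the comparison with the pivot `a` puts `b` into the left sublist, when `e` lists the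
comparisons that go wrong. -/
def goesLeft {α : Type*} [LinearOrder α] (a : α) (e : α → Bool) (b : α) : Bool :=
  xor (decide (b < a)) (e b)

/-- On distinct elements, the errors may be attached to the elements rather than to the positions
in the list. -/
theorem partition_eq_map_coins {α : Type*} [LinearOrder α] [Fintype α] (p : unitInterval) (a : α)
    (l : List α) (hl : l.Nodup) : partition p a l =
      (coins α p).map fun e =>
        (l.filter fun b => goesLeft a e b, l.filter fun b => !goesLeft a e b) := by
  induction l with
  | nil =>
    simp only [partition, List.filter_nil]
    exact (PMF.map_const _ _).symm
  | cons b l ih =>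
    rw [List.nodup_cons] at hl
    rw [partition, ← bind_coins_update p b, ih hl.2, PMF.map_bind]
    refine congrArg _ (funext fun e₀ => ?_)
    rw [PMF.map_comp, PMF.bind_map, ← PMF.bind_pure_comp]
    refine congrArg _ (funext fun e => ?_)
    have h1 : ∀ c ∈ l, goesLeft a (Function.update e b e₀) c = goesLeft a e c := by
      intro c hc
      have : c ≠ b := by rintro rfl; exact hl.1 hc
      simp [goesLeft, this]
    have h2 : goesLeft a (Function.update e b e₀) b = xor (decide (b < a)) e₀ := by
      simp [goesLeft]
    have h3 : l.filter (fun c => !goesLeft a (Function.update e b e₀) c) =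
        l.filter fun c => !goesLeft a e c := List.filter_congr fun c hc => by rw [h1 c hc]
    simp only [Function.comp_def, List.filter_cons, h2, h3, List.filter_congr h1]
    cases xor (decide (b < a)) e₀ <;> simp

/-! ### Random order: the recursion for the law of the number of inversions -/

theorem uniformOfFintype_map_equiv {α β : Type*} [Fintype α] [Nonempty α] [Fintype β] [Nonempty β]
    (f : α ≃ β) : (PMF.uniformOfFintype α).map f = PMF.uniformOfFintype β := by
  ext b
  classical
  rw [PMF.map_apply, tsum_fintype, Finset.sum_eq_single (f.symm b)]
  · simp [Fintype.card_congr f]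
  · intro a _ ha
    rw [if_neg]
    rintro rfl
    simp at ha
  · simp

theorem exists_equiv_eq_ofFn {ι : Type*} [Fintype ι] [DecidableEq ι] {l : List ι} (hl : l.Nodup)
    (hmem : ∀ x, x ∈ l) : ∃ r : Fin (Fintype.card ι) ≃ ι, l = List.ofFn r := by
  have hlen : l.length = Fintype.card ι := by
    rw [← Fintype.card_fin l.length]
    exact Fintype.card_congr (hl.getEquivOfForallMemList l hmem)
  refine ⟨(finCongr hlen.symm).trans (hl.getEquivOfForallMemList l hmem), ?_⟩
  refine List.ext_getElem (by simp [hlen]) fun i h1 h2 => ?_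
  simp

/-- Quicksort only sees the relative order of its input: a uniformly random arrangement of any
`k` distinct elements gives the inversion law of a uniformly random permutation of `Fin k`. -/
theorem bind_uniform_inversionLawOf {ι β : Type*} [Fintype ι] [DecidableEq ι] [LinearOrder β]
    (p : unitInterval) {l : List ι} (hl : l.Nodup) (hmem : ∀ x, x ∈ l) {h : ι → β}
    (hh : Function.Injective h) :
    (PMF.uniformOfFintype (Equiv.Perm ι)).bind (fun π => inversionLawOf p ((l.map π).map h)) =
      inversionLaw (Fintype.card ι) p := by
  obtain ⟨r, rfl⟩ := exists_equiv_eq_ofFn hl hmem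
  obtain ⟨g, hg⟩ : ∃ g : Fin (Fintype.card ι) ≃ ι, StrictMono (h ∘ g) := by
    let _ : LinearOrder ι := LinearOrder.lift' h hh
    exact ⟨(Fintype.orderIsoFinOfCardEq ι rfl).toEquiv, fun x y hxy =>
      (Fintype.orderIsoFinOfCardEq ι rfl).strictMono hxy⟩
  let E : Equiv.Perm ι ≃ Equiv.Perm (Fin (Fintype.card ι)) := Equiv.equivCongr r.symm g.symm
  have hE : ∀ π : Equiv.Perm ι, ((List.ofFn r).map π).map h = (List.ofFn (E π)).map (h ∘ g) := by
    intro π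
    simp only [List.map_ofFn]
    congr 1
    ext i
    simp [E, Equiv.equivCongr]
  rw [inversionLaw, ← uniformOfFintype_map_equiv E, PMF.bind_map]
  refine congrArg _ (funext fun π => ?_)
  rw [hE, inversionLawOf_map p hg]
  rfl

theorem apply_subtypeCongr {ι : Type*} {A : ι → Bool} (π₁ : Equiv.Perm {x // A x = true})
    (π₂ : Equiv.Perm {x // ¬A x = true}) (x : ι) : A (π₁.subtypeCongr π₂ x) = A x := by
  rw [Equiv.Perm.subtypeCongr.apply]
  by_cases hx : A x = true
  · rw [dif_pos hx, hx]; exact (π₁ ⟨x, hx⟩).2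
  · rw [dif_neg hx]
    have := (π₂ ⟨x, hx⟩).2
    rw [Bool.not_eq_true] at this hx
    rw [this, hx]

/-- In a uniformly random arrangement, the elements that satisfy `A` and those that do not are in
independent uniformly random orders. The proof averages over the permutations that preserve `A`. -/
theorem bind_uniform_filter {ι β : Type*} [Fintype ι] [DecidableEq ι] [LinearOrder β]
    (p : unitInterval) {l : List ι} (hl : l.Nodup) (hmem : ∀ x, x ∈ l) {h : ι → β}
    (hh : Function.Injective h) (A : ι → Bool) (K : ℕ → ℕ → PMF ℕ) :
    (PMF.uniformOfFintype (Equiv.Perm ι)).bind (fun τ =>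
      (inversionLawOf p (((l.map τ).filter A).map h)).bind fun i =>
        (inversionLawOf p (((l.map τ).filter fun x => !A x).map h)).bind fun j => K i j) =
    (inversionLaw (Fintype.card {x // A x = true}) p).bind fun i =>
      (inversionLaw (Fintype.card {x // ¬A x = true}) p).bind fun j => K i j := by
  set F : Equiv.Perm ι → PMF ℕ := fun τ =>
    (inversionLawOf p (((l.map τ).filter A).map h)).bind fun i =>
      (inversionLawOf p (((l.map τ).filter fun x => !A x).map h)).bind fun j => K i j with hF
  have hinv : ∀ s : Equiv.Perm ι, (PMF.uniformOfFintype (Equiv.Perm ι)).bind F =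
      (PMF.uniformOfFintype (Equiv.Perm ι)).bind fun τ => F (s * τ) := by
    intro s
    conv_lhs => rw [← uniformOfFintype_map_equiv (Equiv.mulLeft s), PMF.bind_map]
    rfl
  have hsymm : (PMF.uniformOfFintype (Equiv.Perm ι)).bind F =
      (PMF.uniformOfFintype (Equiv.Perm ι)).bind fun τ =>
        (PMF.uniformOfFintype (Equiv.Perm {x // A x = true})).bind fun π₁ =>
          (PMF.uniformOfFintype (Equiv.Perm {x // ¬A x = true})).bind fun π₂ =>
            F (π₁.subtypeCongr π₂ * τ) := by
    rw [PMF.bind_comm]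
    simp_rw [PMF.bind_comm (PMF.uniformOfFintype (Equiv.Perm ι)), ← hinv, PMF.bind_const]
  rw [hsymm, ← PMF.bind_const (PMF.uniformOfFintype (Equiv.Perm ι))
    ((inversionLaw (Fintype.card {x // A x = true}) p).bind _)]
  refine congrArg _ (funext fun τ => ?_)
  -- the two sublists, as lists in the two subtypes
  have hlift : ∀ B : ι → Prop, ∀ [DecidablePred B], ∃ l' : List {x // B x},
      l'.map Subtype.val = (l.map τ).filter (fun x => B x) ∧ l'.Nodup ∧ ∀ x, x ∈ l' := by
    intro B _
    have hB : ∀ x ∈ (l.map τ).filter (fun x => B x), B x := fun x hx => by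
      simpa using (List.mem_filter.1 hx).2
    refine ⟨((l.map τ).filter fun x => B x).attachWith B hB, by simp, ?_, ?_⟩
    · refine List.Nodup.of_map Subtype.val ?_
      rw [List.attachWith_map_subtype_val]
      exact (hl.map τ.injective).filter _
    · intro x
      rw [List.mem_attachWith, List.mem_filter]
      exact ⟨List.mem_map.2 ⟨τ.symm x, hmem _, by simp⟩, by simpa using x.2⟩
  obtain ⟨l₁, hl₁, hn₁, hm₁⟩ := hlift (fun x => A x = true)
  obtain ⟨l₂, hl₂, hn₂, hm₂⟩ := hlift (fun x => ¬A x = true)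
  have e₁ : ∀ (π₁ : Equiv.Perm {x // A x = true}) (π₂ : Equiv.Perm {x // ¬A x = true}),
      ((l.map (π₁.subtypeCongr π₂ * τ)).filter A).map h =
        (l₁.map π₁).map (h ∘ Subtype.val) := by
    intro π₁ π₂
    have : (l.map (π₁.subtypeCongr π₂ * τ)).filter A =
        ((l.map τ).filter fun x => A x = true).map (π₁.subtypeCongr π₂) := by
      rw [Equiv.Perm.coe_mul, ← List.map_map, List.filter_map]
      congr 1
      refine List.filter_congr fun x _ => ?_
      simp [apply_subtypeCongr]
    rw [this, ← hl₁]
    simp only [List.map_map]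
    refine List.map_congr_left fun x _ => ?_
    simp only [Function.comp_apply, Equiv.Perm.subtypeCongr.left_apply_subtype]
  have e₂ : ∀ (π₁ : Equiv.Perm {x // A x = true}) (π₂ : Equiv.Perm {x // ¬A x = true}),
      ((l.map (π₁.subtypeCongr π₂ * τ)).filter fun x => !A x).map h =
        (l₂.map π₂).map (h ∘ Subtype.val) := by
    intro π₁ π₂
    have : (l.map (π₁.subtypeCongr π₂ * τ)).filter (fun x => !A x) =
        ((l.map τ).filter fun x => ¬A x = true).map (π₁.subtypeCongr π₂) := by
      rw [Equiv.Perm.coe_mul, ← List.map_map, List.filter_map]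
      congr 1
      refine List.filter_congr fun x _ => ?_
      simp [apply_subtypeCongr]
    rw [this, ← hl₂]
    simp only [List.map_map]
    refine List.map_congr_left fun x _ => ?_
    simp only [Function.comp_apply, Equiv.Perm.subtypeCongr.right_apply_subtype]
  rw [← bind_uniform_inversionLawOf p hn₁ hm₁ (hh.comp Subtype.val_injective),
    ← bind_uniform_inversionLawOf p hn₂ hm₂ (hh.comp Subtype.val_injective)]
  simp only [hF, e₁, e₂, PMF.bind_bind]
  refine congrArg _ (funext fun π₁ => ?_)
  rw [PMF.bind_comm]

/-- The elements that end up in the left sublist, when the pivot is `a` and `e` lists the errors. -/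
def leftSet {n : ℕ} (a : Fin n) (e : Fin n → Bool) : Finset (Fin n) :=
  Finset.univ.filter fun b => b ≠ a ∧ goesLeft a e b = true

/-- The elements that end up in the right sublist. -/
def rightSet {n : ℕ} (a : Fin n) (e : Fin n → Bool) : Finset (Fin n) :=
  Finset.univ.filter fun b => b ≠ a ∧ ¬goesLeft a e b = true

/-- The inverted pairs that one stage of Quicksort with pivot `a` and errors `e` produces: the
larger element is the pivot or goes to the left, the smaller one is the pivot or goes to the
right. -/
def stagePairs {n : ℕ} (a : Fin n) (e : Fin n → Bool) : Finset (Fin n × Fin n) :=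
  (insert a (leftSet a e) ×ˢ insert a (rightSet a e)).filter fun q => q.2 < q.1

/-- The number of inversions caused at one stage of Quicksort, with pivot `a` and errors `e`. -/
def stageCost {n : ℕ} (a : Fin n) (e : Fin n → Bool) : ℕ := (stagePairs a e).card

theorem countP_eq_card_filter {α : Type*} [DecidableEq α] {l : List α} (hl : l.Nodup)
    (P : α → Prop) [DecidablePred P] : l.countP (fun x => P x) = (l.toFinset.filter P).card := by
  rw [List.countP_eq_length_filter, ← List.toFinset_card_of_nodup (hl.filter _),
    List.toFinset_filter]
  simp

theorem crossCount_eq_card {α : Type*} [LinearOrder α] {s t : List α} (hs : s.Nodup)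
    (ht : t.Nodup) :
    crossCount s t = ((s.toFinset ×ˢ t.toFinset).filter fun q => q.2 < q.1).card := by
  rw [crossCount, ← List.sum_toFinset _ hs, Finset.card_filter, Finset.sum_product]
  simp only [countP_eq_card_filter ht, Finset.card_filter]

theorem splitCost_eq_stageCost {n : ℕ} (a : Fin n) (e : Fin n → Bool) {s t : List (Fin n)}
    (hs : s.Nodup) (ht : t.Nodup) (hs' : s.toFinset = leftSet a e)
    (ht' : t.toFinset = rightSet a e) : splitCost a s t = stageCost a e := by
  have hcons : splitCost a s t = crossCount (a :: s) (a :: t) := by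
    rw [splitCost, crossCount_cons_left, add_comm]
    simp
  have has : a ∉ s := by
    rw [← List.mem_toFinset, hs']
    simp [leftSet]
  have hat : a ∉ t := by
    rw [← List.mem_toFinset, ht']
    simp [rightSet]
  rw [hcons, crossCount_eq_card (List.nodup_cons.2 ⟨has, hs⟩) (List.nodup_cons.2 ⟨hat, ht⟩),
    stageCost, stagePairs, List.toFinset_cons, List.toFinset_cons, hs', ht']

/-- The recursion for the law of `I(n, p)`: the pivot is uniform, the errors are independent, and
given both, the two sublists contribute independent copies for their lengths. -/
theorem inversionLaw_succ (m : ℕ) (p : unitInterval) :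
    inversionLaw (m + 1) p = (PMF.uniformOfFintype (Fin (m + 1))).bind fun a =>
      (coins (Fin (m + 1)) p).bind fun e =>
        (inversionLaw (leftSet a e).card p).bind fun i =>
          (inversionLaw (rightSet a e).card p).bind fun j => PMF.pure (i + j + stageCost a e) := by
  have h0 : inversionLaw (m + 1) p = (PMF.uniformOfFintype (Fin (m + 1))).bind fun a =>
      (PMF.uniformOfFintype (Equiv.Perm (Fin m))).bind fun τ =>
        inversionLawOf p (List.ofFn (Equiv.Perm.decomposeFin.symm (a, τ))) := by
    have hu : PMF.uniformOfFintype (Fin (m + 1) × Equiv.Perm (Fin m)) =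
        (PMF.uniformOfFintype (Fin (m + 1))).bind fun a =>
          (PMF.uniformOfFintype (Equiv.Perm (Fin m))).map fun τ => (a, τ) := by
      ext ⟨a, τ⟩
      classical
      simp only [PMF.uniformOfFintype_apply, PMF.bind_apply, PMF.map_apply, tsum_fintype,
        Prod.mk.injEq, Fintype.card_prod]
      rw [Finset.sum_eq_single a, Finset.sum_eq_single τ]
      · rw [if_pos ⟨rfl, rfl⟩, Nat.cast_mul, ENNReal.mul_inv (by simp) (by simp)]
      · intro τ' _ h
        rw [if_neg fun h' => h h'.2.symm]
      · simp
      · intro a' _ h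
        rw [Finset.sum_eq_zero, mul_zero]
        intro τ' _
        rw [if_neg fun h' => h h'.1.symm]
      · simp
    rw [inversionLaw, ← uniformOfFintype_map_equiv Equiv.Perm.decomposeFin.symm, PMF.bind_map, hu,
      PMF.bind_bind]
    simp only [PMF.bind_map]
    rfl
  rw [h0]
  refine congrArg _ (funext fun a => ?_)
  set g : Fin m → Fin (m + 1) := fun x => Equiv.swap 0 a x.succ with hg
  have hginj : Function.Injective g := fun x y hxy =>
    Fin.succ_injective _ ((Equiv.swap 0 a).injective hxy)
  have hgne : ∀ x, g x ≠ a := by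
    intro x hx
    have : Equiv.swap 0 a x.succ = Equiv.swap 0 a 0 := by rw [Equiv.swap_apply_left]; exact hx
    exact Fin.succ_ne_zero x ((Equiv.swap 0 a).injective this)
  have hgsurj : ∀ b, b ≠ a → ∃ x, g x = b := by
    intro b hb
    have : Equiv.swap 0 a b ≠ 0 := by
      intro h
      exact hb ((Equiv.swap 0 a).injective (by rw [h, Equiv.swap_apply_right]))
    obtain ⟨x, hx⟩ := Fin.exists_succ_eq.2 this
    exact ⟨x, by rw [hg]; simp only [hx, Equiv.swap_apply_self]⟩
  have hlist : ∀ τ : Equiv.Perm (Fin m), List.ofFn (Equiv.Perm.decomposeFin.symm (a, τ)) =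
      a :: ((List.finRange m).map τ).map g := by
    intro τ
    rw [List.ofFn_succ, Equiv.Perm.decomposeFin_symm_apply_zero, List.map_map,
      ← List.ofFn_eq_map]
    simp only [Equiv.Perm.decomposeFin_symm_apply_succ]
    rfl
  have hnd : ∀ τ : Equiv.Perm (Fin m), ((List.finRange m).map τ).Nodup := fun τ =>
    (List.nodup_finRange m).map τ.injective
  have hmem : ∀ (τ : Equiv.Perm (Fin m)) x, x ∈ (List.finRange m).map τ := fun τ x =>
    List.mem_map.2 ⟨τ.symm x, List.mem_finRange _, by simp⟩
  have hcost : ∀ (τ : Equiv.Perm (Fin m)) (e : Fin (m + 1) → Bool),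
      splitCost a ((((List.finRange m).map τ).filter fun x => goesLeft a e (g x)).map g)
        ((((List.finRange m).map τ).filter fun x => !goesLeft a e (g x)).map g) =
          stageCost a e := by
    intro τ e
    refine splitCost_eq_stageCost a e (((hnd τ).filter _).map hginj)
      (((hnd τ).filter _).map hginj) ?_ ?_
    · ext b
      simp only [List.mem_toFinset, List.mem_map, List.mem_filter, leftSet, Finset.mem_filter,
        Finset.mem_univ, true_and]
      constructor
      · rintro ⟨x, ⟨-, hx⟩, rfl⟩
        exact ⟨hgne x, hx⟩
      · rintro ⟨hb, hx⟩
        obtain ⟨x, rfl⟩ := hgsurj b hb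
        exact ⟨x, ⟨List.mem_map.1 (hmem τ x), hx⟩, rfl⟩
    · ext b
      simp only [List.mem_toFinset, List.mem_map, List.mem_filter, rightSet, Finset.mem_filter,
        Finset.mem_univ, true_and]
      constructor
      · rintro ⟨x, ⟨-, hx⟩, rfl⟩
        exact ⟨hgne x, by simpa using hx⟩
      · rintro ⟨hb, hx⟩
        obtain ⟨x, rfl⟩ := hgsurj b hb
        exact ⟨x, ⟨List.mem_map.1 (hmem τ x), by simpa using hx⟩, rfl⟩
  have hcardL : ∀ e, Fintype.card {x // goesLeft a e (g x) = true} = (leftSet a e).card := by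
    intro e
    rw [Fintype.card_subtype, ← Finset.card_map ⟨g, hginj⟩]
    congr 1
    ext b
    simp only [Finset.mem_map, Finset.mem_filter, Finset.mem_univ, true_and,
      Function.Embedding.coeFn_mk, leftSet]
    constructor
    · rintro ⟨x, hx, rfl⟩
      exact ⟨hgne x, hx⟩
    · rintro ⟨hb, hx⟩
      obtain ⟨x, rfl⟩ := hgsurj b hb
      exact ⟨x, hx, rfl⟩
  have hcardR : ∀ e, Fintype.card {x // ¬goesLeft a e (g x) = true} = (rightSet a e).card := by
    intro e
    rw [Fintype.card_subtype, ← Finset.card_map ⟨g, hginj⟩]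
    congr 1
    ext b
    simp only [Finset.mem_map, Finset.mem_filter, Finset.mem_univ, true_and,
      Function.Embedding.coeFn_mk, rightSet]
    constructor
    · rintro ⟨x, hx, rfl⟩
      exact ⟨hgne x, hx⟩
    · rintro ⟨hb, hx⟩
      obtain ⟨x, rfl⟩ := hgsurj b hb
      exact ⟨x, hx, rfl⟩
  simp only [hlist, inversionLawOf_cons,
    fun τ => partition_eq_map_coins p a _ ((hnd τ).map hginj), PMF.bind_map]
  rw [PMF.bind_comm]
  refine congrArg _ (funext fun e => ?_)
  rw [← hcardL, ← hcardR, ← bind_uniform_filter p (List.nodup_finRange m) List.mem_finRange hginj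
    (fun x => goesLeft a e (g x)) fun i j => PMF.pure (i + j + stageCost a e)]
  refine congrArg _ (funext fun τ => ?_)
  simp only [Function.comp_def, ← hcost τ e, List.filter_map]

/-! ### The errors of one stage -/

section Mean

variable {α β : Type*} [Fintype α] [Fintype β]

/-- The expectation of a real function under a law on a finite type. -/
def mean (P : PMF α) (f : α → ℝ) : ℝ := ∑ a, (P a).toReal * f a

theorem sum_toReal_eq_one (P : PMF α) : ∑ a, (P a).toReal = 1 := by
  rw [← ENNReal.toReal_sum fun a _ => P.apply_ne_top a, ← tsum_fintype (L := .unconditional _),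
    PMF.tsum_coe, ENNReal.toReal_one]

theorem mean_const (P : PMF α) (c : ℝ) : mean P (fun _ => c) = c := by
  rw [mean, ← Finset.sum_mul, sum_toReal_eq_one, one_mul]

theorem mean_add (P : PMF α) (f g : α → ℝ) :
    mean P (fun a => f a + g a) = mean P f + mean P g := by
  simp only [mean, mul_add, Finset.sum_add_distrib]

theorem mean_const_mul (P : PMF α) (c : ℝ) (f : α → ℝ) :
    mean P (fun a => c * f a) = c * mean P f := by
  simp only [mean, Finset.mul_sum]
  exact Finset.sum_congr rfl fun a _ => by ring

theorem mean_sum {κ : Type*} (P : PMF α) (s : Finset κ) (f : κ → α → ℝ) :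
    mean P (fun a => ∑ i ∈ s, f i a) = ∑ i ∈ s, mean P (f i) := by
  simp only [mean, Finset.mul_sum]
  exact Finset.sum_comm

theorem mean_mono (P : PMF α) {f g : α → ℝ} (h : ∀ a, f a ≤ g a) : mean P f ≤ mean P g :=
  Finset.sum_le_sum fun a _ => mul_le_mul_of_nonneg_left (h a) ENNReal.toReal_nonneg

theorem mean_bind (P : PMF α) (f : α → PMF β) (g : β → ℝ) :
    mean (P.bind f) g = mean P fun a => mean (f a) g := by
  simp only [mean, PMF.bind_apply, tsum_fintype, Finset.mul_sum]
  rw [Finset.sum_comm]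
  refine Finset.sum_congr rfl fun b _ => ?_
  rw [ENNReal.toReal_sum fun a _ => ENNReal.mul_ne_top (P.apply_ne_top a) ((f a).apply_ne_top b),
    Finset.sum_mul]
  exact Finset.sum_congr rfl fun a _ => by rw [ENNReal.toReal_mul, mul_assoc]

theorem mean_pure (b : β) (g : β → ℝ) : mean (PMF.pure b) g = g b := by
  classical
  rw [mean, Finset.sum_eq_single b]
  · simp
  · intro a _ ha
    simp [ha]
  · simp

theorem mean_map (P : PMF α) (h : α → β) (g : β → ℝ) :
    mean (P.map h) g = mean P fun a => g (h a) := by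
  rw [← PMF.bind_pure_comp, mean_bind]
  simp only [Function.comp_apply, mean_pure]

theorem mean_uniform {n : ℕ} [NeZero n] (f : Fin n → ℝ) :
    mean (PMF.uniformOfFintype (Fin n)) f = (∑ a, f a) / n := by
  simp only [mean, PMF.uniformOfFintype_apply, ← Finset.mul_sum, Fintype.card_fin]
  rw [ENNReal.toReal_inv, ENNReal.toReal_natCast, div_eq_inv_mul]

end Mean

section CoinMoments

variable {ι : Type*} [Fintype ι] [DecidableEq ι] (p : unitInterval)

theorem mean_errorCoin (f : Bool → ℝ) :
    mean (errorCoin p) f = p * f true + (1 - p) * f false := by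
  rw [mean, Fintype.sum_bool]
  simp [errorCoin, ENNReal.toReal_ofReal p.2.1, ENNReal.toReal_ofReal (sub_nonneg.2 p.2.2)]

/-- The indicator of an error on `i`. -/
def err (e : ι → Bool) (i : ι) : ℝ := if e i then 1 else 0

theorem mean_coins (b : ι) (f : (ι → Bool) → ℝ) :
    mean (coins ι p) f = p * mean (coins ι p) (fun e => f (Function.update e b true)) +
      (1 - p) * mean (coins ι p) (fun e => f (Function.update e b false)) := by
  conv_lhs => rw [← bind_coins_update p b]
  rw [mean_bind, mean_errorCoin]
  simp only [mean_map]

theorem mean_err (i : ι) : mean (coins ι p) (fun e => err e i) = p := by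
  rw [mean_coins p i]
  simp [err, mean_const]

theorem mean_err_sub_mul_self (i : ι) :
    mean (coins ι p) (fun e => (err e i - p) * (err e i - p)) = p * (1 - p) := by
  rw [mean_coins p i]
  simp only [err, Function.update_self, mean_const]
  simp only [if_true, Bool.false_eq_true, if_false]
  ring

theorem mean_err_sub_mul {i j : ι} (hij : i ≠ j) :
    mean (coins ι p) (fun e => (err e i - p) * (err e j - p)) = 0 := by
  rw [mean_coins p i]
  simp only [err, Function.update_self, Function.update_of_ne hij.symm, mean_const_mul]
  simp only [if_true, Bool.false_eq_true, if_false]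
  ring

/-- A bound for the variance of a weighted number of errors. -/
theorem mean_sq_sum_err_sub_le (c : ι → ℝ) :
    mean (coins ι p) (fun e => (∑ i, c i * (err e i - p)) ^ 2) ≤ p * ∑ i, c i ^ 2 := by
  have h1 : ∀ e : ι → Bool, (∑ i, c i * (err e i - p)) ^ 2 =
      ∑ i, ∑ j, c i * c j * ((err e i - p) * (err e j - p)) := by
    intro e
    rw [sq, Finset.sum_mul_sum]
    exact Finset.sum_congr rfl fun i _ => Finset.sum_congr rfl fun j _ => by ring
  simp only [h1, mean_sum, mean_const_mul]
  rw [Finset.mul_sum]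
  refine Finset.sum_le_sum fun i _ => ?_
  rw [Finset.sum_eq_single i]
  · rw [mean_err_sub_mul_self]
    have := p.2.1
    nlinarith [mul_nonneg (sq_nonneg (c i)) (mul_nonneg p.2.1 p.2.1)]
  · intro j _ hj
    rw [mean_err_sub_mul p hj.symm, mul_zero]
  · simp

/-- The number of errors. -/
def numErr (e : ι → Bool) : ℝ := ∑ i, err e i

theorem mean_numErr : mean (coins ι p) numErr = Fintype.card ι * p := by
  unfold numErr
  rw [mean_sum]
  simp [mean_err]

theorem mean_numErr_sq_le :
    mean (coins ι p) (fun e => numErr e ^ 2) ≤ Fintype.card ι * p + (Fintype.card ι * p) ^ 2 := by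
  have h1 : ∀ e : ι → Bool, numErr e ^ 2 = (∑ i, (1 : ℝ) * (err e i - p)) ^ 2 +
      (2 * (Fintype.card ι * p) * numErr e + -(Fintype.card ι * p) ^ 2) := by
    intro e
    have : ∑ i, (1 : ℝ) * (err e i - p) = numErr e - Fintype.card ι * p := by
      simp [numErr, Finset.sum_sub_distrib]
    rw [this]; ring
  have h2 := mean_sq_sum_err_sub_le (ι := ι) p fun _ => 1
  simp only [h1, mean_add, mean_const_mul, mean_numErr, mean_const]
  simp only [one_pow, Finset.sum_const, Finset.card_univ, nsmul_eq_mul, mul_one] at h2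
  nlinarith

end CoinMoments

section Stage

variable {n : ℕ} (a : Fin n) (e : Fin n → Bool)

/-- The set of elements whose comparison with the pivot goes wrong. -/
def errSet : Finset (Fin n) := Finset.univ.filter fun b => e b = true

theorem numErr_eq_card : numErr e = (errSet e).card := by
  simp [numErr, err, errSet]

theorem mem_leftSet {b : Fin n} : b ∈ leftSet a e ↔ b ≠ a ∧ xor (decide (b < a)) (e b) = true := by
  simp [leftSet, goesLeft]

theorem mem_rightSet {b : Fin n} :
    b ∈ rightSet a e ↔ b ≠ a ∧ xor (decide (b < a)) (e b) = false := by
  simp [rightSet, goesLeft]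

theorem card_leftSet_add_card_rightSet :
    (leftSet a e).card + (rightSet a e).card + 1 = n := by
  have h : leftSet a e ∪ rightSet a e = Finset.univ.erase a := by
    ext b
    simp only [Finset.mem_union, mem_leftSet, mem_rightSet, Finset.mem_erase, Finset.mem_univ]
    cases xor (decide (b < a)) (e b) <;> simp
  have hd : Disjoint (leftSet a e) (rightSet a e) := by
    rw [Finset.disjoint_left]
    intro b h1 h2
    rw [mem_leftSet] at h1
    rw [mem_rightSet, h1.2] at h2
    simp at h2
  rw [← Finset.card_union_of_disjoint hd, h, Finset.card_erase_of_mem (Finset.mem_univ a),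
    Finset.card_univ, Fintype.card_fin]
  have := a.pos
  omega

theorem abs_card_leftSet_sub_le : |((leftSet a e).card : ℝ) - (a : ℕ)| ≤ numErr e := by
  have h1 : leftSet a e ⊆ Finset.Iio a ∪ errSet e := by
    intro b hb
    rw [mem_leftSet] at hb
    simp only [Finset.mem_union, Finset.mem_Iio, errSet, Finset.mem_filter, Finset.mem_univ,
      true_and]
    by_cases h : b < a
    · exact Or.inl h
    · right; simpa [h] using hb.2
  have h2 : Finset.Iio a ⊆ leftSet a e ∪ errSet e := by
    intro b hb
    have hb' := Finset.mem_Iio.1 hb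
    simp only [Finset.mem_union, mem_leftSet, errSet, Finset.mem_filter, Finset.mem_univ,
      true_and]
    cases h : e b
    · left; simp [hb', hb'.ne]
    · exact Or.inr rfl
  have h3 := (Finset.card_le_card h1).trans (Finset.card_union_le _ _)
  have h4 := (Finset.card_le_card h2).trans (Finset.card_union_le _ _)
  rw [Fin.card_Iio] at h3 h4
  rw [numErr_eq_card, abs_le]
  have h3' : ((leftSet a e).card : ℝ) ≤ (a : ℕ) + (errSet e).card := by exact_mod_cast h3
  have h4' : ((a : ℕ) : ℝ) ≤ (leftSet a e).card + (errSet e).card := by exact_mod_cast h4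
  constructor <;> linarith

theorem mem_stagePairs {b c : Fin n} : (b, c) ∈ stagePairs a e ↔
    (b = a ∨ xor (decide (b < a)) (e b) = true) ∧ (c = a ∨ xor (decide (c < a)) (e c) = false) ∧
      c < b := by
  simp only [stagePairs, Finset.mem_filter, Finset.mem_product, Finset.mem_insert, mem_leftSet,
    mem_rightSet, and_assoc]
  tauto

/-- Of the two elements of a pair inverted at a stage, at least one is erroneous. -/
theorem stageCost_le : (stageCost a e : ℝ) ≤ 2 * n * numErr e := by
  have h : stagePairs a e ⊆ errSet e ×ˢ Finset.univ ∪ Finset.univ ×ˢ errSet e := by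
    rintro ⟨b, c⟩ h
    rw [mem_stagePairs] at h
    simp only [Finset.mem_union, Finset.mem_product, Finset.mem_univ, errSet, Finset.mem_filter,
      true_and, and_true]
    by_contra hcon
    push Not at hcon
    obtain ⟨hb, hc⟩ := hcon
    simp only [ne_eq, Bool.not_eq_true] at hb hc
    obtain ⟨h1, h2, h3⟩ := h
    simp only [hb, hc, Bool.xor_false, decide_eq_true_eq, decide_eq_false_iff_not] at h1 h2
    rcases h1 with rfl | h1 <;> rcases h2 with rfl | h2 <;> order
  have h' := (Finset.card_le_card h).trans (Finset.card_union_le _ _)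
  rw [Finset.card_product, Finset.card_product, Finset.card_univ, Fintype.card_fin] at h'
  rw [numErr_eq_card, stageCost]
  have : ((stagePairs a e).card : ℝ) ≤ (errSet e).card * n + n * (errSet e).card := by
    exact_mod_cast h'
  linarith

/-- The pairs that would be inverted if there were only one error: an error on `b` puts it on the
wrong side of the pivot and of everything between `b` and the pivot. -/
def mainPairs : Finset (Fin n × Fin n) :=
  (Finset.univ.filter fun q : Fin n × Fin n => e q.1 = true ∧ a ≤ q.2 ∧ q.2 < q.1) ∪
    Finset.univ.filter fun q : Fin n × Fin n => e q.2 = true ∧ q.2 < q.1 ∧ q.1 ≤ a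

theorem stagePairs_subset : stagePairs a e ⊆ mainPairs a e ∪ errSet e ×ˢ errSet e := by
  rintro ⟨b, c⟩ h
  rw [mem_stagePairs] at h
  simp only [Finset.mem_union, mainPairs, Finset.mem_product, Finset.mem_univ, errSet,
    Finset.mem_filter, true_and]
  obtain ⟨h1, h2, h3⟩ := h
  cases hb : e b <;> cases hc : e c <;>
    simp only [hb, hc, Bool.xor_false, Bool.xor_true, decide_eq_true_eq, decide_eq_false_iff_not,
      Bool.not_eq_true', Bool.not_eq_false', not_lt] at h1 h2
  · rcases h1 with rfl | h1 <;> rcases h2 with rfl | h2 <;> order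
  · left; right
    refine ⟨rfl, h3, ?_⟩
    rcases h1 with rfl | h1
    · exact le_rfl
    · exact h1.le
  · left; left
    refine ⟨rfl, ?_, h3⟩
    rcases h2 with rfl | h2
    · exact le_rfl
    · exact h2
  · right; simp

theorem mainPairs_subset : mainPairs a e ⊆ stagePairs a e ∪ errSet e ×ˢ errSet e := by
  rintro ⟨b, c⟩ h
  simp only [Finset.mem_union, mem_stagePairs, Finset.mem_product, Finset.mem_univ, errSet,
    Finset.mem_filter, true_and]
  simp only [Finset.mem_union, mainPairs, Finset.mem_filter, Finset.mem_univ, true_and] at h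
  rcases h with ⟨hb, h1, h2⟩ | ⟨hc, h1, h2⟩
  · cases hc : e c
    · left
      have h3 : ¬ b < a := by order
      have h4 : ¬ c < a := by order
      simp [hb, h2, h3, h4]
    · right; exact ⟨hb, rfl⟩
  · cases hb : e b
    · left
      have h4 : c < a := by order
      refine ⟨?_, ?_, h1⟩
      · simpa using h2.eq_or_lt
      · right; simp [h4, hc]
    · right; exact ⟨rfl, hc⟩

/-- The size of `mainPairs` is a sum of independent terms, one for each element. -/
theorem card_mainPairs : ((mainPairs a e).card : ℝ) =
    ∑ b : Fin n, |((b : ℕ) : ℝ) - (a : ℕ)| * err e b := by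
  have hd : Disjoint
      (Finset.univ.filter fun q : Fin n × Fin n => e q.1 = true ∧ a ≤ q.2 ∧ q.2 < q.1)
      (Finset.univ.filter fun q : Fin n × Fin n => e q.2 = true ∧ q.2 < q.1 ∧ q.1 ≤ a) := by
    rw [Finset.disjoint_left]
    rintro ⟨b, c⟩ h1 h2
    simp only [Finset.mem_filter, Finset.mem_univ, true_and] at h1 h2
    obtain ⟨-, h3, h4⟩ := h1
    obtain ⟨-, -, h5⟩ := h2
    order
  have h1 : (Finset.univ.filter fun q : Fin n × Fin n =>
      e q.1 = true ∧ a ≤ q.2 ∧ q.2 < q.1).card = ∑ b, if e b then (b : ℕ) - (a : ℕ) else 0 := by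
    rw [Finset.card_filter, Fintype.sum_prod_type]
    refine Finset.sum_congr rfl fun b _ => ?_
    cases h : e b
    · simp [h]
    · rw [if_pos rfl, ← Fin.card_Ico, ← Finset.card_filter]
      congr 1
      ext c
      simp [h]
  have h2 : (Finset.univ.filter fun q : Fin n × Fin n =>
      e q.2 = true ∧ q.2 < q.1 ∧ q.1 ≤ a).card = ∑ b, if e b then (a : ℕ) - (b : ℕ) else 0 := by
    rw [Finset.card_filter, Fintype.sum_prod_type_right]
    refine Finset.sum_congr rfl fun c _ => ?_
    cases h : e c
    · simp [h]
    · rw [if_pos rfl, ← Fin.card_Ioc, ← Finset.card_filter]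
      congr 1
      ext b
      simp [h]
  rw [mainPairs, Finset.card_union_of_disjoint hd, h1, h2, ← Finset.sum_add_distrib]
  push_cast
  refine Finset.sum_congr rfl fun b _ => ?_
  cases h : e b
  · simp [err, h]
  · rcases le_total (a : ℕ) (b : ℕ) with hab | hab
    · have : ((a : ℕ) : ℝ) ≤ (b : ℕ) := by exact_mod_cast hab
      simp [err, h, Nat.sub_eq_zero_of_le hab, Nat.cast_sub hab, abs_of_nonneg (sub_nonneg.2 this)]
    · have : ((b : ℕ) : ℝ) ≤ (a : ℕ) := by exact_mod_cast hab
      simp [err, h, Nat.sub_eq_zero_of_le hab, Nat.cast_sub hab, abs_of_nonpos (sub_nonpos.2 this)]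

theorem abs_stageCost_sub_le :
    |(stageCost a e : ℝ) - ∑ b : Fin n, |((b : ℕ) : ℝ) - (a : ℕ)| * err e b| ≤ numErr e ^ 2 := by
  have h1 := (Finset.card_le_card (stagePairs_subset a e)).trans (Finset.card_union_le _ _)
  have h2 := (Finset.card_le_card (mainPairs_subset a e)).trans (Finset.card_union_le _ _)
  rw [Finset.card_product] at h1 h2
  rw [← card_mainPairs, numErr_eq_card, stageCost, abs_le]
  have h1' : ((stagePairs a e).card : ℝ) ≤
      (mainPairs a e).card + (errSet e).card * (errSet e).card := by exact_mod_cast h1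
  have h2' : ((mainPairs a e).card : ℝ) ≤
      (stagePairs a e).card + (errSet e).card * (errSet e).card := by exact_mod_cast h2
  constructor <;> nlinarith

end Stage

/-! ### Mean cost of one stage -/

theorem sum_abs_sub_range_of_le {k a : ℕ} (h : k ≤ a) :
    ∑ j ∈ Finset.range k, |(j : ℝ) - a| = k * a - k * (k - 1) / 2 := by
  induction k with
  | zero => simp
  | succ k ih =>
    have : (k : ℝ) + 1 ≤ a := by exact_mod_cast h
    rw [Finset.sum_range_succ, ih (by omega), abs_of_nonpos (by linarith)]
    push_cast; ring

theorem sum_abs_sub_range {n a : ℕ} (h : a ≤ n) :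
    ∑ j ∈ Finset.range n, |(j : ℝ) - a| =
      (a : ℝ) * (a + 1) / 2 + ((n : ℝ) - 1 - a) * (n - a) / 2 := by
  induction n, h using Nat.le_induction with
  | base => rw [sum_abs_sub_range_of_le le_rfl]; ring
  | succ n hn ih =>
    have : (a : ℝ) ≤ n := by exact_mod_cast hn
    rw [Finset.sum_range_succ, ih, abs_of_nonneg (by linarith)]
    push_cast; ring

theorem sum_range_cast (n : ℕ) : ∑ j ∈ Finset.range n, (j : ℝ) = n * (n - 1) / 2 := by
  induction n with
  | zero => simp
  | succ n ih => rw [Finset.sum_range_succ, ih]; push_cast; ring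

theorem sum_range_cast_sq (n : ℕ) :
    ∑ j ∈ Finset.range n, (j : ℝ) ^ 2 = n * (n - 1) * (2 * n - 1) / 6 := by
  induction n with
  | zero => simp
  | succ n ih => rw [Finset.sum_range_succ, ih]; push_cast; ring

section StageMean

variable {n : ℕ} (p : unitInterval) (a : Fin n)

theorem abs_sum_abs_sub_le :
    |∑ b : Fin n, |((b : ℕ) : ℝ) - (a : ℕ)| -
      (((a : ℕ) : ℝ) ^ 2 + ((n : ℝ) - (a : ℕ)) ^ 2) / 2| ≤ (n : ℝ) := by
  have ha : ((a : ℕ) : ℝ) ≤ n := by exact_mod_cast a.2.le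
  have ha0 : (0 : ℝ) ≤ ((a : ℕ) : ℝ) := Nat.cast_nonneg _
  rw [Fin.sum_univ_eq_sum_range (fun j => |(j : ℝ) - (a : ℕ)|), sum_abs_sub_range a.2.le, abs_le]
  constructor <;> nlinarith

theorem sum_abs_sub_sq_le : ∑ b : Fin n, |((b : ℕ) : ℝ) - (a : ℕ)| ^ 2 ≤ (n : ℝ) ^ 3 := by
  have : ∀ b ∈ Finset.univ (α := Fin n), |((b : ℕ) : ℝ) - (a : ℕ)| ^ 2 ≤ (n : ℝ) ^ 2 := by
    intro b _
    have ha : ((a : ℕ) : ℝ) ≤ n := by exact_mod_cast a.2.le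
    have ha0 : (0 : ℝ) ≤ ((a : ℕ) : ℝ) := Nat.cast_nonneg _
    have hb : ((b : ℕ) : ℝ) ≤ n := by exact_mod_cast b.2.le
    have hb0 : (0 : ℝ) ≤ ((b : ℕ) : ℝ) := Nat.cast_nonneg _
    gcongr
    rw [abs_le]
    constructor <;> linarith
  refine (Finset.sum_le_sum this).trans (le_of_eq ?_)
  simp
  ring

/-- The normalized cost of one stage concentrates: its mean is `p` times a sum of distances to the
pivot up to the pairs with two errors, and its variance is of order `n ^ 3 * p`. The parameter `δ`
balances the two terms of the inequality `2 * |x| ≤ s + x ^ 2 / s`. -/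
theorem mean_abs_stageCost_le (hp : 0 < (p : ℝ)) {δ : ℝ} (hδ : 0 < δ) :
    mean (coins (Fin n) p) (fun e => |(stageCost a e : ℝ) / p -
      (((a : ℕ) : ℝ) ^ 2 + ((n : ℝ) - (a : ℕ)) ^ 2) / 2|) ≤
        2 * n + (n : ℝ) ^ 2 * p + (n : ℝ) ^ 2 * δ / 2 + n / (2 * δ * p) := by
  have hn : (0 : ℝ) < n := by exact_mod_cast a.pos
  set s : ℝ := (n : ℝ) ^ 2 * p * δ with hs
  have hs0 : 0 < s := by positivity
  set Q : ℝ := (((a : ℕ) : ℝ) ^ 2 + ((n : ℝ) - (a : ℕ)) ^ 2) / 2 with hQ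
  set c : Fin n → ℝ := fun b => |((b : ℕ) : ℝ) - (a : ℕ)| with hc
  have hpt : ∀ e : Fin n → Bool, |(stageCost a e : ℝ) / p - Q| ≤
      (1 / p) * (numErr e ^ 2 + ((1 / (2 * s)) * (∑ b, c b * (err e b - p)) ^ 2 +
        (s / 2 + p * n))) := by
    intro e
    have h1 := abs_stageCost_sub_le a e
    have h2 := abs_sum_abs_sub_le a
    set X := ∑ b, c b * (err e b - p) with hX
    have h3 : X = ∑ b, c b * err e b - p * ∑ b, c b := by
      rw [hX, Finset.mul_sum, ← Finset.sum_sub_distrib]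
      exact Finset.sum_congr rfl fun b _ => by ring
    have h4 : |X| ≤ (1 / (2 * s)) * X ^ 2 + s / 2 := by
      have h5 : 0 ≤ (1 / (2 * s)) * (|X| - s) ^ 2 := by positivity
      have h6 : (1 / (2 * s)) * (|X| - s) ^ 2 = (1 / (2 * s)) * X ^ 2 + s / 2 - |X| := by
        rw [sub_sq, sq_abs]; field_simp; ring
      linarith
    have h5 : |(stageCost a e : ℝ) - p * Q| ≤ numErr e ^ 2 + |X| + p * n := by
      have h6 : (stageCost a e : ℝ) - p * Q = ((stageCost a e : ℝ) - ∑ b, c b * err e b) + X +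
          p * (∑ b, c b - Q) := by rw [h3]; ring
      rw [h6]
      refine (abs_add_le _ _).trans (add_le_add ((abs_add_le _ _).trans
        (add_le_add h1 le_rfl)) ?_)
      rw [abs_mul, abs_of_pos hp]
      exact mul_le_mul_of_nonneg_left h2 hp.le
    have h7 : (stageCost a e : ℝ) / p - Q = (1 / p) * ((stageCost a e : ℝ) - p * Q) := by
      field_simp
    rw [h7, abs_mul, abs_of_pos (by positivity : (0 : ℝ) < 1 / p)]
    refine mul_le_mul_of_nonneg_left ?_ (by positivity)
    linarith
  refine (mean_mono _ hpt).trans ?_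
  rw [mean_const_mul, mean_add, mean_add, mean_const_mul, mean_const]
  have h1 := mean_numErr_sq_le (ι := Fin n) p
  have h2 := (mean_sq_sum_err_sub_le p c).trans
    (mul_le_mul_of_nonneg_left (sum_abs_sub_sq_le a) hp.le)
  rw [Fintype.card_fin] at h1
  have h3 : (1 / (p : ℝ)) * (n * p + (n * p) ^ 2 + ((1 / (2 * s)) * (p * (n : ℝ) ^ 3) +
      (s / 2 + p * n))) = 2 * n + (n : ℝ) ^ 2 * p + (n : ℝ) ^ 2 * δ / 2 + n / (2 * δ * p) := by
    rw [hs]; field_simp; ring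
  rw [← h3]
  gcongr

theorem mean_abs_stageCost_le_crude (hp : 0 < (p : ℝ)) :
    mean (coins (Fin n) p) (fun e => |(stageCost a e : ℝ) / p -
      (((a : ℕ) : ℝ) ^ 2 + ((n : ℝ) - (a : ℕ)) ^ 2) / 2|) ≤ 5 / 2 * (n : ℝ) ^ 2 := by
  have ha : ((a : ℕ) : ℝ) ≤ n := by exact_mod_cast a.2.le
  have ha0 : (0 : ℝ) ≤ ((a : ℕ) : ℝ) := Nat.cast_nonneg _
  have hpt : ∀ e : Fin n → Bool, |(stageCost a e : ℝ) / p -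
      (((a : ℕ) : ℝ) ^ 2 + ((n : ℝ) - (a : ℕ)) ^ 2) / 2| ≤
        (2 * (n : ℝ) / p) * numErr e + (n : ℝ) ^ 2 / 2 := by
    intro e
    have h1 : (stageCost a e : ℝ) / p ≤ (2 * (n : ℝ) / p) * numErr e := by
      rw [div_mul_eq_mul_div]
      exact div_le_div_of_nonneg_right (stageCost_le a e) hp.le
    have h2 : 0 ≤ (stageCost a e : ℝ) / p := by positivity
    have h3 : (((a : ℕ) : ℝ) ^ 2 + ((n : ℝ) - (a : ℕ)) ^ 2) / 2 ≤ (n : ℝ) ^ 2 / 2 := by nlinarith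
    have h4 : 0 ≤ (((a : ℕ) : ℝ) ^ 2 + ((n : ℝ) - (a : ℕ)) ^ 2) / 2 := by positivity
    rw [abs_le]
    constructor <;> linarith
  refine (mean_mono _ hpt).trans (le_of_eq ?_)
  rw [mean_add, mean_const_mul, mean_const]
  have : mean (coins (Fin n) p) (fun e => numErr e) = n * p := by
    simpa using mean_numErr (ι := Fin n) p
  rw [this]
  field_simp
  ring

/-- A bound for the error made when one stage of Quicksort is replaced by one step of the limiting
equation, both on the scale `n ^ 2`. The summands come from the sizes of the two sublists, from the
cost of the stage, and from rounding the uniform variable to a pivot. -/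
def stageError (p : unitInterval) {n : ℕ} (a : Fin n) (e : Fin n → Bool) : ℝ :=
  2 * n * (numErr e + 1) + 2 * n * (numErr e + 2) +
    (|(stageCost a e : ℝ) / p - (((a : ℕ) : ℝ) ^ 2 + ((n : ℝ) - (a : ℕ)) ^ 2) / 2| + 2 * n)

theorem mean_stageError : mean (coins (Fin n) p) (stageError p a) =
    4 * n ^ 2 * p + 8 * n + mean (coins (Fin n) p) (fun e => |(stageCost a e : ℝ) / p -
      (((a : ℕ) : ℝ) ^ 2 + ((n : ℝ) - (a : ℕ)) ^ 2) / 2|) := by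
  have h : ∀ e, stageError p a e = 4 * n * numErr e + (|(stageCost a e : ℝ) / p -
      (((a : ℕ) : ℝ) ^ 2 + ((n : ℝ) - (a : ℕ)) ^ 2) / 2| + 8 * n) := by
    intro e; rw [stageError]; ring
  have h1 : mean (coins (Fin n) p) (fun e => numErr e) = n * p := by
    simpa using mean_numErr (ι := Fin n) p
  rw [funext h, mean_add, mean_add, mean_const_mul, mean_const, h1]
  ring

theorem mean_stageError_le_crude (hp : 0 < (p : ℝ)) :
    mean (coins (Fin n) p) (stageError p a) ≤ 15 * (n : ℝ) ^ 2 := by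
  have hn : (1 : ℝ) ≤ n := by exact_mod_cast a.pos
  have h := mean_abs_stageCost_le_crude p a hp
  have hp1 : (p : ℝ) ≤ 1 := p.2.2
  rw [mean_stageError]
  nlinarith [mul_nonneg (sub_nonneg.2 hp1) (sq_nonneg (n : ℝ))]

theorem mean_stageError_le (hp : 0 < (p : ℝ)) {δ : ℝ} (hδ : 0 < δ) (hδ1 : δ ≤ 1)
    (hn : 1 ≤ n * (δ ^ 2 * p)) :
    mean (coins (Fin n) p) (stageError p a) ≤ (15 * p + δ) * (n : ℝ) ^ 2 := by
  have hn0 : (0 : ℝ) < n := by exact_mod_cast a.pos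
  have h := mean_abs_stageCost_le p a hp hδ
  rw [mean_stageError]
  have h1 : (n : ℝ) / (2 * δ * p) ≤ (n : ℝ) ^ 2 * δ / 2 := by
    rw [div_le_iff₀ (by positivity)]
    nlinarith
  have h2 : (n : ℝ) ≤ (n : ℝ) ^ 2 * p := by
    have h3 : δ ^ 2 * p ≤ p :=
      mul_le_of_le_one_left hp.le (pow_le_one₀ hδ.le hδ1)
    have h4 : 1 ≤ (n : ℝ) * p := hn.trans (by gcongr)
    nlinarith
  linarith

theorem card_sq_add_card_sq_le (e : Fin n → Bool) :
    ((leftSet a e).card : ℝ) ^ 2 + ((rightSet a e).card : ℝ) ^ 2 ≤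
      ((a : ℕ) : ℝ) ^ 2 + ((n : ℝ) - 1 - (a : ℕ)) ^ 2 + 4 * n * numErr e := by
  have h0 : ((leftSet a e).card : ℝ) + (rightSet a e).card + 1 = n := by
    exact_mod_cast card_leftSet_add_card_rightSet a e
  have h1 := abs_le.1 (abs_card_leftSet_sub_le a e)
  have hN : 0 ≤ numErr e := (abs_nonneg _).trans (abs_card_leftSet_sub_le a e)
  have hl : (0 : ℝ) ≤ (leftSet a e).card := Nat.cast_nonneg _
  have hr : (0 : ℝ) ≤ (rightSet a e).card := Nat.cast_nonneg _
  have ha : ((a : ℕ) : ℝ) + 1 ≤ n := by exact_mod_cast a.2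
  have ha0 : (0 : ℝ) ≤ ((a : ℕ) : ℝ) := Nat.cast_nonneg _
  generalize ((leftSet a e).card : ℝ) = l at *
  generalize ((rightSet a e).card : ℝ) = r at *
  generalize ((a : ℕ) : ℝ) = x at *
  generalize numErr e = N at *
  have e1 : l ^ 2 - x ^ 2 ≤ N * (2 * n) := by
    have : (l - x) * (l + x) ≤ N * (l + x) := mul_le_mul_of_nonneg_right (by linarith) (by linarith)
    have : N * (l + x) ≤ N * (2 * n) := mul_le_mul_of_nonneg_left (by linarith) hN
    nlinarith
  have e2 : r ^ 2 - ((n : ℝ) - 1 - x) ^ 2 ≤ N * (2 * n) := by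
    have : (x - l) * (r + (n - 1 - x)) ≤ N * (r + (n - 1 - x)) :=
      mul_le_mul_of_nonneg_right (by linarith) (by linarith)
    have : N * (r + (n - 1 - x)) ≤ N * (2 * n) := mul_le_mul_of_nonneg_left (by linarith) hN
    have : r - (n - 1 - x) = x - l := by linarith
    have : r ^ 2 - ((n : ℝ) - 1 - x) ^ 2 = (x - l) * (r + (n - 1 - x)) := by
      rw [← this]; ring
    linarith
  linarith

end StageMean

/-- The mean, over a uniform pivot and the errors, of the sum of the squares of the sizes of the two
sublists. For small `p` the factor is less than one, which makes the recursion a contraction. -/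
theorem mean_card_sq_le (m : ℕ) (p : unitInterval) :
    mean (PMF.uniformOfFintype (Fin (m + 1))) (fun a => mean (coins (Fin (m + 1)) p) fun e =>
      ((leftSet a e).card : ℝ) ^ 2 + ((rightSet a e).card : ℝ) ^ 2) ≤
        (2 / 3 + 4 * p) * ((m + 1 : ℕ) : ℝ) ^ 2 := by
  set n := m + 1 with hn
  have hn1 : (1 : ℝ) ≤ n := by rw [hn]; push_cast; linarith [Nat.cast_nonneg (α := ℝ) m]
  have h1 : ∀ a : Fin n, mean (coins (Fin n) p) (fun e =>
      ((leftSet a e).card : ℝ) ^ 2 + ((rightSet a e).card : ℝ) ^ 2) ≤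
      (((a : ℕ) : ℝ) ^ 2 + ((n : ℝ) - 1 - (a : ℕ)) ^ 2) + 4 * n * (n * p) := by
    intro a
    refine (mean_mono _ (card_sq_add_card_sq_le a)).trans (le_of_eq ?_)
    have : mean (coins (Fin n) p) (fun e => numErr e) = n * p := by
      simpa using mean_numErr (ι := Fin n) p
    rw [mean_add, mean_const_mul, mean_const, this]
  refine (mean_mono _ h1).trans ?_
  rw [mean_add, mean_const, mean_uniform,
    Fin.sum_univ_eq_sum_range (fun j => (j : ℝ) ^ 2 + ((n : ℝ) - 1 - j) ^ 2)]
  have h2 : ∑ j ∈ Finset.range n, ((j : ℝ) ^ 2 + ((n : ℝ) - 1 - j) ^ 2) =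
      (n : ℝ) * (n - 1) * (2 * n - 1) / 3 := by
    have : ∀ j : ℕ, (j : ℝ) ^ 2 + ((n : ℝ) - 1 - j) ^ 2 =
        2 * (j : ℝ) ^ 2 - 2 * (n - 1) * j + (n - 1) ^ 2 := fun j => by ring
    simp only [this, Finset.sum_add_distrib, Finset.sum_sub_distrib, ← Finset.mul_sum,
      sum_range_cast, sum_range_cast_sq, Finset.sum_const, Finset.card_range, nsmul_eq_mul]
    ring
  rw [h2]
  have h3 : (n : ℝ) * (n - 1) * (2 * n - 1) / 3 / n ≤ 2 / 3 * (n : ℝ) ^ 2 := by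
    rw [div_le_iff₀ (by linarith)]
    nlinarith
  linarith

/-! ### Existence of a solution of the limiting equation -/

instance : IsProbabilityMeasure uniform01 :=
  ⟨by rw [uniform01, Measure.restrict_apply_univ, Real.volume_Icc]; simp⟩

theorem integral_uniform01 (f : ℝ → ℝ) : ∫ u, f u ∂uniform01 = ∫ u in (0 : ℝ)..1, f u := by
  rw [uniform01, integral_Icc_eq_integral_Ioc, intervalIntegral.integral_of_le zero_le_one]

theorem integrable_uniform01 {f : ℝ → ℝ} (hf : Continuous f) : Integrable f uniform01 :=
  hf.integrableOn_Icc

theorem lintegral_uniform01 {f : ℝ → ℝ} (hf : Continuous f) (h0 : ∀ u, 0 ≤ f u) :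
    ∫⁻ u, ENNReal.ofReal (f u) ∂uniform01 = ENNReal.ofReal (∫ u in (0 : ℝ)..1, f u) := by
  rw [← integral_uniform01, ofReal_integral_eq_lintegral_ofReal (integrable_uniform01 hf)
    (Eventually.of_forall h0)]

theorem integral_quartic (a b c d e : ℝ) :
    ∫ u in (0 : ℝ)..1, (a + b * u + c * u ^ 2 + d * u ^ 3 + e * u ^ 4) =
      a + b / 2 + c / 3 + d / 4 + e / 5 := by
  have hi : ∀ f : ℝ → ℝ, Continuous f → IntervalIntegrable f volume 0 1 := fun f hf =>
    hf.intervalIntegrable _ _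
  rw [intervalIntegral.integral_add (hi _ (by fun_prop)) (hi _ (by fun_prop)),
    intervalIntegral.integral_add (hi _ (by fun_prop)) (hi _ (by fun_prop)),
    intervalIntegral.integral_add (hi _ (by fun_prop)) (hi _ (by fun_prop)),
    intervalIntegral.integral_add (hi _ (by fun_prop)) (hi _ (by fun_prop))]
  have h1 : ∫ u in (0 : ℝ)..1, b * u = b / 2 := by
    rw [intervalIntegral.integral_const_mul, integral_id]
    ring
  simp only [h1, intervalIntegral.integral_const_mul, intervalIntegral.integral_const,
    integral_pow]
  norm_num
  ring

/-- The integral over `[0, 1]` of a polynomial of degree at most four, given by its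
coefficients. -/
theorem integral_eq_of_quartic {f : ℝ → ℝ} (a b c d e : ℝ)
    (h : ∀ u, f u = a + b * u + c * u ^ 2 + d * u ^ 3 + e * u ^ 4) :
    ∫ u in (0 : ℝ)..1, f u = a + b / 2 + c / 3 + d / 4 + e / 5 := by
  rw [← integral_quartic, funext h]

/-- The toll function of the limiting equation. -/
def toll (u : ℝ) : ℝ := (u ^ 2 + (1 - u) ^ 2) / 2

theorem toll_nonneg (u : ℝ) : 0 ≤ toll u := by unfold toll; positivity

theorem continuous_toll : Continuous toll := by unfold toll; fun_prop

theorem lintegral_prod_mul_mul {A B C : Type*} [MeasurableSpace A] [MeasurableSpace B]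
    [MeasurableSpace C] (μ : Measure A) (ν : Measure B) (ρ : Measure C) [SFinite μ] [SFinite ν]
    [SFinite ρ] {f : A → ℝ≥0∞} {g : B → ℝ≥0∞} {h : C → ℝ≥0∞} (hf : Measurable f)
    (hg : Measurable g) (hh : Measurable h) :
    ∫⁻ z, f z.1 * (g z.2.1 * h z.2.2) ∂(μ.prod (ν.prod ρ)) =
      (∫⁻ x, f x ∂μ) * ((∫⁻ y, g y ∂ν) * ∫⁻ u, h u ∂ρ) := by
  refine (lintegral_prod_mul (f := f) (g := fun w : B × C => g w.1 * h w.2) hf.aemeasurable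
    ((hg.comp measurable_fst).mul (hh.comp measurable_snd)).aemeasurable).trans ?_
  rw [lintegral_prod_mul hg.aemeasurable hh.aemeasurable]

section Tree

/-- The probability space of the limit: independent uniform variables, indexed by the nodes of the
infinite binary tree. -/
def treeMeasure : Measure (List Bool → ℝ) := Measure.infinitePi fun _ => uniform01

instance : IsProbabilityMeasure treeMeasure := by unfold treeMeasure; infer_instance

/-- The variables of the subtree below the child `b` of the root. -/
def subtree (b : Bool) (ω : List Bool → ℝ) : List Bool → ℝ := fun v => ω (b :: v)

/-- The tree whose two subtrees and root are given. -/
def graft (z : (List Bool → ℝ) × (List Bool → ℝ) × ℝ) : List Bool → ℝ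
  | [] => z.2.2
  | true :: v => z.1 v
  | false :: v => z.2.1 v

theorem measurable_subtree (b : Bool) : Measurable (subtree b) := by
  unfold subtree; fun_prop

theorem measurable_graft : Measurable graft := by
  refine measurable_pi_lambda _ fun v => ?_
  match v with
  | [] => exact measurable_snd.comp measurable_snd
  | true :: v => exact (measurable_pi_apply v).comp measurable_fst
  | false :: v => exact (measurable_pi_apply v).comp (measurable_fst.comp measurable_snd)

/-- A product over nodes of the tree, split into the two subtrees and the root. -/
theorem prod_list_bool (s : Finset (List Bool)) (f : List Bool → ℝ≥0∞) :
    ∏ v ∈ s, f v =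
      (∏ v ∈ s.preimage (List.cons true) (List.cons_injective.injOn), f (true :: v)) *
      ((∏ v ∈ s.preimage (List.cons false) (List.cons_injective.injOn), f (false :: v)) *
        if [] ∈ s then f [] else 1) := by
  classical
  rw [Finset.prod_preimage' (List.cons true), Finset.prod_preimage' (List.cons false),
    ← Finset.prod_ite_eq s [] f, Finset.prod_filter, Finset.prod_filter,
    ← Finset.prod_mul_distrib, ← Finset.prod_mul_distrib]
  refine Finset.prod_congr rfl fun v _ => ?_
  match v with
  | [] => simp
  | true :: v => simp
  | false :: v => simp

theorem map_graft : (treeMeasure.prod (treeMeasure.prod uniform01)).map graft = treeMeasure := by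
  refine Measure.eq_infinitePi _ fun s t ht => ?_
  rw [Measure.map_apply measurable_graft
    (MeasurableSet.pi s.countable_toSet fun i _ => ht i)]
  have hpre : graft ⁻¹' Set.pi s t =
      (Set.pi (s.preimage (List.cons true) (List.cons_injective.injOn) : Set (List Bool))
        fun v => t (true :: v)) ×ˢ
      ((Set.pi (s.preimage (List.cons false) (List.cons_injective.injOn) : Set (List Bool))
        fun v => t (false :: v)) ×ˢ (if [] ∈ s then t [] else Set.univ)) := by
    ext ⟨x, y, u⟩
    simp only [Set.mem_preimage, Set.mem_pi, Set.mem_prod, Finset.mem_coe, Finset.mem_preimage]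
    constructor
    · intro h
      refine ⟨fun v hv => h _ hv, fun v hv => h _ hv, ?_⟩
      split_ifs with h0
      · exact h _ h0
      · trivial
    · rintro ⟨h1, h2, h3⟩ v hv
      match v with
      | [] => rw [if_pos hv] at h3; exact h3
      | true :: v => exact h1 v hv
      | false :: v => exact h2 v hv
  rw [hpre, Measure.prod_prod, Measure.prod_prod, prod_list_bool, treeMeasure,
    Measure.infinitePi_pi _ fun v _ => ht _, Measure.infinitePi_pi _ fun v _ => ht _]
  split_ifs <;> simp

/-- The two subtrees and the root variable are independent, and the subtrees are distributed like
the whole tree. -/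
theorem map_split : treeMeasure.map (fun ω => (subtree true ω, subtree false ω, ω [])) =
    treeMeasure.prod (treeMeasure.prod uniform01) := by
  conv_lhs => rw [← map_graft]
  have hm : Measurable fun ω : List Bool → ℝ => (subtree true ω, subtree false ω, ω []) :=
    (measurable_subtree true).prodMk ((measurable_subtree false).prodMk (measurable_pi_apply _))
  rw [Measure.map_map hm measurable_graft]
  exact Measure.map_id

/-- The iterates of the limiting equation from `0`: the sum over the nodes of depth less than `k`
of the toll at the node, times the squared length of its interval. -/
def treeSum : ℕ → (List Bool → ℝ) → ℝ
  | 0, _ => 0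
  | k + 1, ω => ω [] ^ 2 * treeSum k (subtree true ω) +
      (1 - ω []) ^ 2 * treeSum k (subtree false ω) + toll (ω [])

theorem treeSum_nonneg (k : ℕ) : ∀ ω, 0 ≤ treeSum k ω := by
  induction k with
  | zero => intro ω; exact le_rfl
  | succ k ih =>
    intro ω
    have := ih (subtree true ω)
    have := ih (subtree false ω)
    have := toll_nonneg (ω [])
    rw [treeSum]
    positivity

/-- The tolls are nonnegative, so the iterates increase. -/
theorem treeSum_le_succ (k : ℕ) : ∀ ω, treeSum k ω ≤ treeSum (k + 1) ω := by
  induction k with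
  | zero => intro ω; exact treeSum_nonneg 1 ω
  | succ k ih =>
    intro ω
    rw [treeSum, treeSum]
    have := ih (subtree true ω)
    have := ih (subtree false ω)
    gcongr

theorem measurable_treeSum (k : ℕ) : Measurable (treeSum k) := by
  induction k with
  | zero => exact measurable_const
  | succ k ih =>
    have h1 := ih.comp (measurable_subtree true)
    have h2 := ih.comp (measurable_subtree false)
    have h0 : Measurable fun ω : List Bool → ℝ => ω [] := measurable_pi_apply _
    exact (((h0.pow_const 2).mul h1).add (((h0.const_sub 1).pow_const 2).mul h2)).add
      (continuous_toll.measurable.comp h0)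

theorem lintegral_comp_split {F : (List Bool → ℝ) × (List Bool → ℝ) × ℝ → ℝ≥0∞}
    (hF : Measurable F) : ∫⁻ ω, F (subtree true ω, subtree false ω, ω []) ∂treeMeasure =
      ∫⁻ z, F z ∂(treeMeasure.prod (treeMeasure.prod uniform01)) := by
  have hm : Measurable fun ω : List Bool → ℝ => (subtree true ω, subtree false ω, ω []) :=
    (measurable_subtree true).prodMk ((measurable_subtree false).prodMk (measurable_pi_apply _))
  rw [← map_split, lintegral_map hF hm]

/-- The mean of one step of the equation, with arbitrary coefficient functions `f`, `g` of the root
and additional term `h`; it serves for both moments of `treeSum`. -/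
theorem lintegral_step {G : (List Bool → ℝ) → ℝ} (hG : Measurable G) (hG0 : ∀ ω, 0 ≤ G ω)
    {f g h : ℝ → ℝ} (hf : Continuous f) (hg : Continuous g) (hh : Continuous h)
    (hf0 : ∀ u, 0 ≤ f u) (hg0 : ∀ u, 0 ≤ g u) (hh0 : ∀ u, 0 ≤ h u) :
    ∫⁻ ω, ENNReal.ofReal (f (ω []) * G (subtree true ω) + g (ω []) * G (subtree false ω) +
      h (ω [])) ∂treeMeasure =
      ENNReal.ofReal (∫ u in (0 : ℝ)..1, f u) * ∫⁻ ω, ENNReal.ofReal (G ω) ∂treeMeasure +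
      ENNReal.ofReal (∫ u in (0 : ℝ)..1, g u) * ∫⁻ ω, ENNReal.ofReal (G ω) ∂treeMeasure +
      ENNReal.ofReal (∫ u in (0 : ℝ)..1, h u) := by
  let F : (List Bool → ℝ) × (List Bool → ℝ) × ℝ → ℝ≥0∞ := fun z =>
    ENNReal.ofReal (G z.1) * (1 * ENNReal.ofReal (f z.2.2)) +
      1 * (ENNReal.ofReal (G z.2.1) * ENNReal.ofReal (g z.2.2)) +
      1 * (1 * ENNReal.ofReal (h z.2.2))
  have hpt : ∀ ω : List Bool → ℝ, ENNReal.ofReal (f (ω []) * G (subtree true ω) +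
      g (ω []) * G (subtree false ω) + h (ω [])) =
      F (subtree true ω, subtree false ω, ω []) := by
    intro ω
    have h1 := mul_nonneg (hf0 (ω [])) (hG0 (subtree true ω))
    have h2 := mul_nonneg (hg0 (ω [])) (hG0 (subtree false ω))
    rw [ENNReal.ofReal_add (add_nonneg h1 h2) (hh0 _), ENNReal.ofReal_add h1 h2,
      ENNReal.ofReal_mul (hf0 _), ENNReal.ofReal_mul (hg0 _)]
    simp only [F, one_mul]
    ring
  have mG : Measurable fun ω => ENNReal.ofReal (G ω) := hG.ennreal_ofReal
  have mf : Measurable fun u => ENNReal.ofReal (f u) := hf.measurable.ennreal_ofReal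
  have mg : Measurable fun u => ENNReal.ofReal (g u) := hg.measurable.ennreal_ofReal
  have mh : Measurable fun u => ENNReal.ofReal (h u) := hh.measurable.ennreal_ofReal
  simp only [hpt]
  rw [lintegral_comp_split (F := F) (by fun_prop)]
  simp only [F]
  rw [lintegral_add_left (by fun_prop),
    lintegral_add_left (by fun_prop),
    lintegral_prod_mul_mul treeMeasure treeMeasure uniform01 mG
      (measurable_const (a := (1 : ℝ≥0∞))) mf,
    lintegral_prod_mul_mul treeMeasure treeMeasure uniform01
      (measurable_const (a := (1 : ℝ≥0∞))) mG mg,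
    lintegral_prod_mul_mul treeMeasure treeMeasure uniform01
      (measurable_const (a := (1 : ℝ≥0∞))) (measurable_const (a := (1 : ℝ≥0∞))) mh,
    lintegral_uniform01 hf hf0, lintegral_uniform01 hg hg0, lintegral_uniform01 hh hh0]
  simp only [lintegral_const, measure_univ, one_mul]
  ring

theorem lintegral_treeSum_le (k : ℕ) :
    ∫⁻ ω, ENNReal.ofReal (treeSum k ω) ∂treeMeasure ≤ 1 := by
  induction k with
  | zero => simp [treeSum]
  | succ k ih =>
    simp only [treeSum]
    rw [lintegral_step (measurable_treeSum k) (treeSum_nonneg k) (by fun_prop) (by fun_prop)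
      continuous_toll (fun u => sq_nonneg u) (fun u => sq_nonneg (1 - u)) toll_nonneg,
      integral_eq_of_quartic (f := fun u : ℝ => u ^ 2) 0 0 1 0 0 (fun u => by ring),
      integral_eq_of_quartic (f := fun u : ℝ => (1 - u) ^ 2) 1 (-2) 1 0 0 (fun u => by ring),
      integral_eq_of_quartic (f := toll) (1 / 2) (-1) 1 0 0 (fun u => by unfold toll; ring)]
    refine (add_le_add_left (add_le_add (mul_le_mul_right ih _) (mul_le_mul_right ih _)) _).trans ?_
    rw [mul_one, mul_one, ← ENNReal.ofReal_add (by norm_num) (by norm_num),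
      ← ENNReal.ofReal_add (by norm_num) (by norm_num), ← ENNReal.ofReal_one]
    exact ENNReal.ofReal_le_ofReal (by norm_num)

theorem lintegral_treeSum_sq_le (k : ℕ) :
    ∫⁻ ω, ENNReal.ofReal (treeSum k ω ^ 2) ∂treeMeasure ≤ ENNReal.ofReal (7 / 2) := by
  induction k with
  | zero => simp [treeSum]
  | succ k ih =>
    have hpt : ∀ ω, ENNReal.ofReal (treeSum (k + 1) ω ^ 2) ≤
        ENNReal.ofReal ((fun u : ℝ => 2 * (u ^ 2 + (1 - u) ^ 2) * u ^ 2) (ω []) *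
          treeSum k (subtree true ω) ^ 2 +
          (fun u : ℝ => 2 * (u ^ 2 + (1 - u) ^ 2) * (1 - u) ^ 2) (ω []) *
          treeSum k (subtree false ω) ^ 2 + (fun u : ℝ => 2 * toll u ^ 2) (ω [])) := by
      intro ω
      refine ENNReal.ofReal_le_ofReal ?_
      rw [treeSum]
      generalize treeSum k (subtree true ω) = x
      generalize treeSum k (subtree false ω) = y
      generalize ω [] = u
      -- `(s + c) ^ 2 ≤ 2 * s ^ 2 + 2 * c ^ 2`, and the Cauchy-Schwarz inequality for `s`
      nlinarith [sq_nonneg (u ^ 2 * x + (1 - u) ^ 2 * y - toll u),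
        sq_nonneg (u * (1 - u) * (x - y))]
    refine (lintegral_mono hpt).trans ?_
    have hc := continuous_toll
    rw [lintegral_step (G := fun ω => treeSum k ω ^ 2)
      (f := fun u : ℝ => 2 * (u ^ 2 + (1 - u) ^ 2) * u ^ 2)
      (g := fun u : ℝ => 2 * (u ^ 2 + (1 - u) ^ 2) * (1 - u) ^ 2)
      (h := fun u : ℝ => 2 * toll u ^ 2) ((measurable_treeSum k).pow_const 2)
      (fun ω => sq_nonneg _) (by fun_prop) (by fun_prop) (by fun_prop)
      (fun u => by positivity) (fun u => by positivity) (fun u => by positivity),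
      integral_eq_of_quartic (f := fun u : ℝ => 2 * (u ^ 2 + (1 - u) ^ 2) * u ^ 2)
        0 0 2 (-4) 4 (fun u => by ring),
      integral_eq_of_quartic (f := fun u : ℝ => 2 * (u ^ 2 + (1 - u) ^ 2) * (1 - u) ^ 2)
        2 (-8) 14 (-12) 4 (fun u => by ring),
      integral_eq_of_quartic (f := fun u : ℝ => 2 * toll u ^ 2)
        (1 / 2) (-2) 4 (-4) 2 (fun u => by unfold toll; ring)]
    refine (add_le_add_left (add_le_add (mul_le_mul_right ih _) (mul_le_mul_right ih _)) _).trans ?_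
    rw [← ENNReal.ofReal_mul (by norm_num), ← ENNReal.ofReal_mul (by norm_num),
      ← ENNReal.ofReal_add (by norm_num) (by norm_num),
      ← ENNReal.ofReal_add (by norm_num) (by norm_num)]
    exact ENNReal.ofReal_le_ofReal (by norm_num)

/-- The limit of the increasing sequence `treeSum k`. -/
def treeLimit (ω : List Bool → ℝ) : ℝ := (⨆ k, ENNReal.ofReal (treeSum k ω)).toReal

theorem measurable_treeLimit : Measurable treeLimit :=
  (Measurable.iSup fun k => (measurable_treeSum k).ennreal_ofReal).ennreal_toReal

theorem treeLimit_nonneg (ω : List Bool → ℝ) : 0 ≤ treeLimit ω := ENNReal.toReal_nonneg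

theorem ae_tendsto_treeLimit :
    ∀ᵐ ω ∂treeMeasure, Tendsto (fun k => treeSum k ω) atTop (𝓝 (treeLimit ω)) := by
  have hmono : ∀ ω, Monotone fun k => ENNReal.ofReal (treeSum k ω) := fun ω =>
    monotone_nat_of_le_succ fun k => ENNReal.ofReal_le_ofReal (treeSum_le_succ k ω)
  have hlt : ∫⁻ ω, ⨆ k, ENNReal.ofReal (treeSum k ω) ∂treeMeasure ≠ ∞ := by
    rw [lintegral_iSup (fun k => (measurable_treeSum k).ennreal_ofReal)
      (fun i j hij ω => hmono ω hij)]
    exact ne_top_of_le_ne_top ENNReal.one_ne_top (iSup_le lintegral_treeSum_le)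
  filter_upwards [ae_lt_top (Measurable.iSup fun k => (measurable_treeSum k).ennreal_ofReal) hlt]
    with ω hω
  have h := (ENNReal.tendsto_toReal hω.ne).comp (tendsto_atTop_iSup (hmono ω))
  refine h.congr fun k => ?_
  simp [ENNReal.toReal_ofReal (treeSum_nonneg k ω)]

theorem map_subtree (b : Bool) : treeMeasure.map (subtree b) = treeMeasure := by
  have hm : Measurable fun ω : List Bool → ℝ => (subtree true ω, subtree false ω, ω []) :=
    (measurable_subtree true).prodMk ((measurable_subtree false).prodMk (measurable_pi_apply _))
  cases b
  · have : subtree false = (fun z : (List Bool → ℝ) × (List Bool → ℝ) × ℝ => z.2.1) ∘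
        fun ω : List Bool → ℝ => (subtree true ω, subtree false ω, ω []) := rfl
    rw [this, ← Measure.map_map (by fun_prop) hm, map_split]
    have : (fun z : (List Bool → ℝ) × (List Bool → ℝ) × ℝ => z.2.1) = Prod.fst ∘ Prod.snd := rfl
    rw [this, ← Measure.map_map (by fun_prop) (by fun_prop)]
    simp
  · have : subtree true = Prod.fst ∘
        fun ω : List Bool → ℝ => (subtree true ω, subtree false ω, ω []) := rfl
    rw [this, ← Measure.map_map (by fun_prop) hm, map_split]
    simp

theorem ae_treeLimit_eq : ∀ᵐ ω ∂treeMeasure, treeLimit ω = ω [] ^ 2 * treeLimit (subtree true ω) +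
    (1 - ω []) ^ 2 * treeLimit (subtree false ω) + toll (ω []) := by
  have hsub : ∀ b, ∀ᵐ ω ∂treeMeasure,
      Tendsto (fun k => treeSum k (subtree b ω)) atTop (𝓝 (treeLimit (subtree b ω))) := by
    intro b
    have h := ae_tendsto_treeLimit
    rw [← map_subtree b] at h
    exact ae_of_ae_map (measurable_subtree b).aemeasurable h
  filter_upwards [ae_tendsto_treeLimit, hsub true, hsub false] with ω h h1 h2
  refine tendsto_nhds_unique (h.comp (tendsto_add_atTop_nat 1)) ?_
  exact ((h1.const_mul _).add (h2.const_mul _)).add_const _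

/-- Existence of a solution of the limiting equation; it is nonnegative, has mean at most one, and
has a finite second moment. -/
theorem exists_solution : ∃ μ : ProbabilityMeasure ℝ, SolvesEquation (μ : Measure ℝ) ∧
    ∫⁻ x, ENNReal.ofReal |x| ∂(μ : Measure ℝ) ≤ 1 ∧ MemLp id 2 (μ : Measure ℝ) := by
  have hmeas := measurable_treeLimit
  refine ⟨⟨treeMeasure.map treeLimit, Measure.isProbabilityMeasure_map hmeas.aemeasurable⟩,
    ?_, ?_, ?_⟩
  · rw [SolvesEquation, ProbabilityMeasure.coe_mk]
    conv_lhs => rw [← Measure.map_id (μ := uniform01)]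
    rw [Measure.map_prod_map _ _ hmeas measurable_id,
      Measure.map_prod_map _ _ hmeas (by fun_prop), ← map_split,
      Measure.map_map (by fun_prop) (by fun_prop), Measure.map_map]
    · exact Measure.map_congr (ae_treeLimit_eq.mono fun ω h => h.symm)
    · fun_prop
    · exact (measurable_subtree true).prodMk
        ((measurable_subtree false).prodMk (measurable_pi_apply _))
  · rw [ProbabilityMeasure.coe_mk, lintegral_map (by fun_prop) hmeas]
    have h : ∀ᵐ ω ∂treeMeasure, ENNReal.ofReal |treeLimit ω| =
        liminf (fun k => ENNReal.ofReal (treeSum k ω)) atTop := by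
      filter_upwards [ae_tendsto_treeLimit] with ω hω
      rw [(ENNReal.tendsto_ofReal hω).liminf_eq, abs_of_nonneg (treeLimit_nonneg ω)]
    rw [lintegral_congr_ae h]
    refine (lintegral_liminf_le fun k => (measurable_treeSum k).ennreal_ofReal).trans ?_
    exact liminf_le_of_frequently_le' (Frequently.of_forall lintegral_treeSum_le)
  · rw [ProbabilityMeasure.coe_mk]
    have h : ∀ᵐ ω ∂treeMeasure, ENNReal.ofReal (treeLimit ω ^ 2) =
        liminf (fun k => ENNReal.ofReal (treeSum k ω ^ 2)) atTop := by
      filter_upwards [ae_tendsto_treeLimit] with ω hω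
      rw [(ENNReal.tendsto_ofReal (hω.pow 2)).liminf_eq]
    have h2 : ∫⁻ ω, ENNReal.ofReal (treeLimit ω ^ 2) ∂treeMeasure ≤ ENNReal.ofReal (7 / 2) := by
      rw [lintegral_congr_ae h]
      refine (lintegral_liminf_le fun k =>
        ((measurable_treeSum k).pow_const 2).ennreal_ofReal).trans ?_
      exact liminf_le_of_frequently_le' (Frequently.of_forall lintegral_treeSum_sq_le)
    rw [memLp_two_iff_integrable_sq measurable_id.aestronglyMeasurable,
      ← lintegral_ofReal_ne_top_iff_integrable (by fun_prop)
        (Eventually.of_forall fun x => sq_nonneg _), lintegral_map (by fun_prop) hmeas]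
    exact ne_top_of_le_ne_top ENNReal.ofReal_ne_top h2

end Tree

/-! ### Mean and variance of a solution -/

theorem integrable_prod_mul_mul {μ : Measure ℝ} [SFinite μ] {f g h : ℝ → ℝ}
    (hf : Integrable f μ) (hg : Integrable g μ)
    (hh : Continuous h) : Integrable (fun z : ℝ × ℝ × ℝ => f z.1 * (g z.2.1 * h z.2.2))
      (μ.prod (μ.prod uniform01)) :=
  hf.mul_prod (hg.mul_prod (integrable_uniform01 hh))

section Moments

variable {μ : Measure ℝ} [IsProbabilityMeasure μ]

theorem integral_prod_mul_mul (f g h : ℝ → ℝ) :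
    ∫ z : ℝ × ℝ × ℝ, f z.1 * (g z.2.1 * h z.2.2) ∂(μ.prod (μ.prod uniform01)) =
      (∫ x, f x ∂μ) * ((∫ y, g y ∂μ) * ∫ u in (0 : ℝ)..1, h u) := by
  refine (integral_prod_mul (f := f) (g := fun w : ℝ × ℝ => g w.1 * h w.2)).trans ?_
  rw [integral_prod_mul, integral_uniform01]

theorem mean_eq_one (hμ : SolvesEquation μ) (hint : Integrable id μ) : ∫ x, x ∂μ = 1 := by
  have hc := continuous_toll
  have hone : Integrable (fun _ : ℝ => (1 : ℝ)) μ := integrable_const 1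
  have hid : Integrable (fun x : ℝ => x) μ := hint
  have h := integral_map (μ := μ.prod (μ.prod uniform01)) (φ := fun z : ℝ × ℝ × ℝ =>
      z.2.2 ^ 2 * z.1 + (1 - z.2.2) ^ 2 * z.2.1 + (z.2.2 ^ 2 + (1 - z.2.2) ^ 2) / 2)
    (by fun_prop) (f := fun x => x) (by fun_prop)
  rw [show Measure.map _ (μ.prod (μ.prod uniform01)) = μ from hμ] at h
  have hpt : ∀ z : ℝ × ℝ × ℝ, z.2.2 ^ 2 * z.1 + (1 - z.2.2) ^ 2 * z.2.1 +
      (z.2.2 ^ 2 + (1 - z.2.2) ^ 2) / 2 =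
      z.1 * (1 * (fun u => u ^ 2) z.2.2) + 1 * (z.2.1 * (fun u => (1 - u) ^ 2) z.2.2) +
        1 * (1 * toll z.2.2) := by
    intro z; simp only [toll]; ring
  simp only [hpt] at h
  have i1 := integrable_prod_mul_mul (μ := μ) (h := fun u : ℝ => u ^ 2) hid hone (by fun_prop)
  have i2 := integrable_prod_mul_mul (μ := μ) (h := fun u : ℝ => (1 - u) ^ 2) hone hid (by fun_prop)
  have i3 := integrable_prod_mul_mul (μ := μ) hone hone hc
  rw [integral_add (i1.fun_add i2) i3, integral_add i1 i2,
    integral_prod_mul_mul (fun x => x) (fun _ => 1) (fun u => u ^ 2),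
    integral_prod_mul_mul (fun _ => 1) (fun y => y) (fun u => (1 - u) ^ 2),
    integral_prod_mul_mul (fun _ => 1) (fun _ => 1) toll,
    integral_eq_of_quartic (f := fun u : ℝ => u ^ 2) 0 0 1 0 0 (fun u => by ring),
    integral_eq_of_quartic (f := fun u : ℝ => (1 - u) ^ 2) 1 (-2) 1 0 0 (fun u => by ring),
    integral_eq_of_quartic (f := toll) (1 / 2) (-1) 1 0 0 (fun u => by unfold toll; ring)] at h
  simp only [integral_const, probReal_univ, smul_eq_mul, one_mul] at h
  linarith

theorem integral_sq_eq (hμ : SolvesEquation μ) (hL2 : MemLp id 2 μ) :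
    ∫ x, x ^ 2 ∂μ = 13 / 12 := by
  have hc := continuous_toll
  have hone : Integrable (fun _ : ℝ => (1 : ℝ)) μ := integrable_const 1
  have hid : Integrable (fun x : ℝ => x) μ := hL2.integrable one_le_two
  have hsq : Integrable (fun x : ℝ => x ^ 2) μ := hL2.integrable_sq
  have hmean := mean_eq_one hμ hid
  have h := integral_map (μ := μ.prod (μ.prod uniform01)) (φ := fun z : ℝ × ℝ × ℝ =>
      z.2.2 ^ 2 * z.1 + (1 - z.2.2) ^ 2 * z.2.1 + (z.2.2 ^ 2 + (1 - z.2.2) ^ 2) / 2)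
    (by fun_prop) (f := fun x => x ^ 2) (by fun_prop)
  rw [show Measure.map _ (μ.prod (μ.prod uniform01)) = μ from hμ] at h
  have hpt : ∀ z : ℝ × ℝ × ℝ, (z.2.2 ^ 2 * z.1 + (1 - z.2.2) ^ 2 * z.2.1 +
      (z.2.2 ^ 2 + (1 - z.2.2) ^ 2) / 2) ^ 2 =
      (fun x => x ^ 2) z.1 * (1 * (fun u => u ^ 4) z.2.2) +
      1 * ((fun x => x ^ 2) z.2.1 * (fun u => (1 - u) ^ 4) z.2.2) +
      1 * (1 * (fun u => toll u ^ 2) z.2.2) +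
      z.1 * (z.2.1 * (fun u => 2 * (u ^ 2 * (1 - u) ^ 2)) z.2.2) +
      z.1 * (1 * (fun u => 2 * (u ^ 2 * toll u)) z.2.2) +
      1 * (z.2.1 * (fun u => 2 * ((1 - u) ^ 2 * toll u)) z.2.2) := by
    intro z; simp only [toll]; ring
  simp only [hpt] at h
  have i1 := integrable_prod_mul_mul (μ := μ) (h := fun u : ℝ => u ^ 4) hsq hone (by fun_prop)
  have i2 := integrable_prod_mul_mul (μ := μ) (h := fun u : ℝ => (1 - u) ^ 4) hone hsq (by fun_prop)
  have i3 := integrable_prod_mul_mul (μ := μ) (h := fun u : ℝ => toll u ^ 2) hone hone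
    (by fun_prop)
  have i4 := integrable_prod_mul_mul (μ := μ) (h := fun u : ℝ => 2 * (u ^ 2 * (1 - u) ^ 2)) hid hid
    (by fun_prop)
  have i5 := integrable_prod_mul_mul (μ := μ) (h := fun u : ℝ => 2 * (u ^ 2 * toll u)) hid hone
    (by fun_prop)
  have i6 := integrable_prod_mul_mul (μ := μ) (h := fun u : ℝ => 2 * ((1 - u) ^ 2 * toll u)) hone
    hid (by fun_prop)
  rw [integral_add ((((i1.fun_add i2).fun_add i3).fun_add i4).fun_add i5) i6,
    integral_add (((i1.fun_add i2).fun_add i3).fun_add i4) i5,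
    integral_add ((i1.fun_add i2).fun_add i3) i4,
    integral_add (i1.fun_add i2) i3, integral_add i1 i2,
    integral_prod_mul_mul (fun x => x ^ 2) (fun _ => 1) (fun u => u ^ 4),
    integral_prod_mul_mul (fun _ => 1) (fun y => y ^ 2) (fun u => (1 - u) ^ 4),
    integral_prod_mul_mul (fun _ => 1) (fun _ => 1) (fun u => toll u ^ 2),
    integral_prod_mul_mul (fun x => x) (fun y => y) (fun u => 2 * (u ^ 2 * (1 - u) ^ 2)),
    integral_prod_mul_mul (fun x => x) (fun _ => 1) (fun u => 2 * (u ^ 2 * toll u)),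
    integral_prod_mul_mul (fun _ => 1) (fun y => y) (fun u => 2 * ((1 - u) ^ 2 * toll u)),
    integral_eq_of_quartic (f := fun u : ℝ => u ^ 4) 0 0 0 0 1 (fun u => by ring),
    integral_eq_of_quartic (f := fun u : ℝ => (1 - u) ^ 4) 1 (-4) 6 (-4) 1 (fun u => by ring),
    integral_eq_of_quartic (f := fun u : ℝ => toll u ^ 2) (1 / 4) (-1) 2 (-2) 1
      (fun u => by unfold toll; ring),
    integral_eq_of_quartic (f := fun u : ℝ => 2 * (u ^ 2 * (1 - u) ^ 2)) 0 0 2 (-4) 2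
      (fun u => by ring),
    integral_eq_of_quartic (f := fun u : ℝ => 2 * (u ^ 2 * toll u)) 0 0 1 (-2) 2
      (fun u => by unfold toll; ring),
    integral_eq_of_quartic (f := fun u : ℝ => 2 * ((1 - u) ^ 2 * toll u)) 1 (-4) 7 (-6) 2
      (fun u => by unfold toll; ring), hmean] at h
  simp only [integral_const, probReal_univ, smul_eq_mul, one_mul] at h
  linarith

theorem variance_eq (hμ : SolvesEquation μ) (hL2 : MemLp id 2 μ) : variance id μ = 1 / 12 := by
  rw [variance_eq_sub hL2]
  have h1 := integral_sq_eq hμ hL2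
  have h2 := mean_eq_one hμ (hL2.integrable one_le_two)
  simp only [Pi.pow_apply, id_eq, h1, h2]
  norm_num

end Moments

/-! ### Couplings, the Wasserstein distance, and uniqueness -/

section ToMeasure

theorem toMeasure_bind {α β : Type*} [Fintype α] [MeasurableSpace β] (P : PMF α) (f : α → PMF β) :
    (P.bind f).toMeasure = ∑ a, P a • (f a).toMeasure := by
  ext s hs
  rw [PMF.toMeasure_bind_apply P f s hs, tsum_fintype, Measure.finsetSum_apply]
  simp

theorem toMeasure_prod {α β : Type*} [Countable α] [Countable β] [MeasurableSpace α]
    [MeasurableSpace β] [MeasurableSingletonClass α] [MeasurableSingletonClass β] (P : PMF α)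
    (Q : PMF β) :
    P.toMeasure.prod Q.toMeasure = (P.bind fun i => Q.map fun j => (i, j)).toMeasure := by
  refine Measure.ext_of_singleton fun ⟨i, j⟩ => ?_
  rw [← Set.singleton_prod_singleton, Measure.prod_prod, Set.singleton_prod_singleton,
    PMF.toMeasure_apply_singleton _ _ (measurableSet_singleton _),
    PMF.toMeasure_apply_singleton _ _ (measurableSet_singleton _),
    PMF.toMeasure_apply_singleton _ _ (measurableSet_singleton _), PMF.bind_apply,
    tsum_eq_single i, PMF.map_apply, tsum_eq_single j]
  · simp
  · intro j' hj
    rw [if_neg]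
    rintro h
    exact hj (Prod.ext_iff.1 h).2.symm
  · intro i' hi
    rw [PMF.map_apply, ENNReal.tsum_eq_zero.2, mul_zero]
    intro j'
    rw [if_neg]
    rintro h
    exact hi (Prod.ext_iff.1 h).1.symm

theorem toMeasure_bind_bind_pure (P Q : PMF ℕ) (f : ℕ × ℕ → ℕ) :
    (P.bind fun i => Q.bind fun j => PMF.pure (f (i, j))).toMeasure =
      (P.toMeasure.prod Q.toMeasure).map f := by
  rw [toMeasure_prod, PMF.toMeasure_map _ _ (measurable_of_countable f), PMF.map_bind]
  simp only [PMF.map_comp]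
  rfl

end ToMeasure

theorem measurable_limitStep : Measurable fun z : ℝ × ℝ × ℝ =>
    z.2.2 ^ 2 * z.1 + (1 - z.2.2) ^ 2 * z.2.1 + (z.2.2 ^ 2 + (1 - z.2.2) ^ 2) / 2 := by
  fun_prop

theorem lintegral_prod_left {A B C : Type*} [MeasurableSpace A] [MeasurableSpace B]
    [MeasurableSpace C] (μ : Measure A) (ν : Measure B) (ρ : Measure C) [IsProbabilityMeasure ν]
    [IsProbabilityMeasure ρ] {f : A → ℝ≥0∞} (hf : Measurable f) :
    ∫⁻ z, f z.1 ∂(μ.prod (ν.prod ρ)) = ∫⁻ x, f x ∂μ :=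
  measurePreserving_fst.lintegral_comp hf

theorem lintegral_prod_mid {A B C : Type*} [MeasurableSpace A] [MeasurableSpace B]
    [MeasurableSpace C] (μ : Measure A) (ν : Measure B) (ρ : Measure C) [IsProbabilityMeasure μ]
    [IsProbabilityMeasure ν] [IsProbabilityMeasure ρ] {f : B → ℝ≥0∞} (hf : Measurable f) :
    ∫⁻ z, f z.2.1 ∂(μ.prod (ν.prod ρ)) = ∫⁻ x, f x ∂ν :=
  (measurePreserving_fst.comp (measurePreserving_snd (μ := μ) (ν := ν.prod ρ))).lintegral_comp hf

/-- There is a coupling of a law `Q` on `ℕ` with `μ` under which the count, divided by `s`, and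
`n ^ 2` times the real variable have mean distance at most `c`. -/
def HasCoupling (μ : Measure ℝ) (s : ℝ) (Q : PMF ℕ) (n : ℕ) (c : ℝ) : Prop :=
  ∃ γ : Measure (ℕ × ℝ), γ.map Prod.fst = Q.toMeasure ∧ γ.map Prod.snd = μ ∧
    ∫⁻ z, ENNReal.ofReal |(z.1 : ℝ) / s - (n : ℝ) ^ 2 * z.2| ∂γ ≤ ENNReal.ofReal c

theorem HasCoupling.mono {μ : Measure ℝ} {s : ℝ} {Q : PMF ℕ} {n : ℕ} {c c' : ℝ}
    (h : HasCoupling μ s Q n c) (hc : c ≤ c') : HasCoupling μ s Q n c' := by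
  obtain ⟨γ, h1, h2, h3⟩ := h
  exact ⟨γ, h1, h2, h3.trans (ENNReal.ofReal_le_ofReal hc)⟩

theorem abs_step_le (s T n k l x y x' y' u A B C : ℝ) (hA : |k ^ 2 - n ^ 2 * u ^ 2| ≤ A)
    (hB : |l ^ 2 - n ^ 2 * (1 - u) ^ 2| ≤ B) (hC : |T / s - n ^ 2 * toll u| ≤ C) :
    |(x + x' + T) / s - n ^ 2 * (u ^ 2 * y + (1 - u) ^ 2 * y' + toll u)| ≤
      |x / s - k ^ 2 * y| + |x' / s - l ^ 2 * y'| + A * |y| + B * |y'| + C := by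
  have h : (x + x' + T) / s - n ^ 2 * (u ^ 2 * y + (1 - u) ^ 2 * y' + toll u) =
      (x / s - k ^ 2 * y) + (x' / s - l ^ 2 * y') + (k ^ 2 - n ^ 2 * u ^ 2) * y +
        (l ^ 2 - n ^ 2 * (1 - u) ^ 2) * y' + (T / s - n ^ 2 * toll u) := by ring
  rw [h]
  refine (abs_add_le _ _).trans (add_le_add ((abs_add_le _ _).trans (add_le_add
    ((abs_add_le _ _).trans (add_le_add (abs_add_le _ _) ?_)) ?_)) hC)
  · rw [abs_mul]; gcongr
  · rw [abs_mul]; gcongr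

/-- Couplings for the two sublists give a coupling for the whole list. The coupling is the mixture,
over the outcome `θ` of the first stage, of products of the given couplings with the law `ρ θ` of
the uniform variable given `θ`. -/
theorem hasCoupling_step {μ : Measure ℝ} [IsProbabilityMeasure μ] (hμ : SolvesEquation μ)
    (hμ1 : ∫⁻ x, ENNReal.ofReal |x| ∂μ ≤ 1) {Θ : Type*} [Fintype Θ] (P : PMF Θ) (k l T : Θ → ℕ)
    (ρ : Θ → Measure ℝ) [∀ θ, IsProbabilityMeasure (ρ θ)] (hρ : ∑ θ, P θ • ρ θ = uniform01)
    (L : ℕ → PMF ℕ) (n : ℕ)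
    (hL : L n = P.bind fun θ => (L (k θ)).bind fun i => (L (l θ)).bind fun j =>
      PMF.pure (i + j + T θ))
    {s : ℝ} {D : ℕ → ℝ} (hD : ∀ m, 0 ≤ D m)
    (hk : ∀ θ, HasCoupling μ s (L (k θ)) (k θ) (D (k θ)))
    (hl : ∀ θ, HasCoupling μ s (L (l θ)) (l θ) (D (l θ)))
    {A B C : Θ → ℝ} (hA0 : ∀ θ, 0 ≤ A θ) (hB0 : ∀ θ, 0 ≤ B θ) (hC0 : ∀ θ, 0 ≤ C θ)
    (hA : ∀ θ, ∀ᵐ u ∂ρ θ, |(k θ : ℝ) ^ 2 - (n : ℝ) ^ 2 * u ^ 2| ≤ A θ)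
    (hB : ∀ θ, ∀ᵐ u ∂ρ θ, |(l θ : ℝ) ^ 2 - (n : ℝ) ^ 2 * (1 - u) ^ 2| ≤ B θ)
    (hC : ∀ θ, ∀ᵐ u ∂ρ θ, |(T θ : ℝ) / s - (n : ℝ) ^ 2 * toll u| ≤ C θ) :
    HasCoupling μ s (L n) n (mean P fun θ => D (k θ) + D (l θ) + A θ + B θ + C θ) := by
  choose γ₁ h₁f h₁s h₁c using hk
  choose γ₂ h₂f h₂s h₂c using hl
  have p₁ : ∀ θ, IsProbabilityMeasure (γ₁ θ) := fun θ => by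
    have : IsProbabilityMeasure ((γ₁ θ).map Prod.fst) := by rw [h₁f]; infer_instance
    exact Measure.isProbabilityMeasure_of_map Prod.fst
  have p₂ : ∀ θ, IsProbabilityMeasure (γ₂ θ) := fun θ => by
    have : IsProbabilityMeasure ((γ₂ θ).map Prod.fst) := by rw [h₂f]; infer_instance
    exact Measure.isProbabilityMeasure_of_map Prod.fst
  let S : ℝ × ℝ × ℝ → ℝ := fun z =>
    z.2.2 ^ 2 * z.1 + (1 - z.2.2) ^ 2 * z.2.1 + (z.2.2 ^ 2 + (1 - z.2.2) ^ 2) / 2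
  have hS : Measurable S := measurable_limitStep
  let Φ : Θ → (ℕ × ℝ) × (ℕ × ℝ) × ℝ → ℕ × ℝ := fun θ z =>
    (z.1.1 + z.2.1.1 + T θ, S (z.1.2, z.2.1.2, z.2.2))
  have hΦ : ∀ θ, Measurable (Φ θ) := fun θ => by fun_prop
  refine ⟨∑ θ, P θ • ((γ₁ θ).prod ((γ₂ θ).prod (ρ θ))).map (Φ θ), ?_, ?_, ?_⟩
  · rw [← Measure.mapₗ_apply_of_measurable measurable_fst, map_sum, hL, toMeasure_bind]
    refine Finset.sum_congr rfl fun θ _ => ?_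
    rw [map_smul, Measure.mapₗ_apply_of_measurable measurable_fst,
      Measure.map_map measurable_fst (hΦ θ),
      toMeasure_bind_bind_pure _ _ (fun q => q.1 + q.2 + T θ), ← h₁f, ← h₂f]
    have h : ((γ₂ θ).prod (ρ θ)).map (fun w => w.1.1) = (γ₂ θ).map Prod.fst := by
      rw [show (fun w : (ℕ × ℝ) × ℝ => w.1.1) = Prod.fst ∘ Prod.fst from rfl,
        ← Measure.map_map measurable_fst measurable_fst]
      simp
    rw [← h, Measure.map_prod_map _ _ measurable_fst (by fun_prop),
      Measure.map_map (measurable_of_countable _) (by fun_prop)]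
    rfl
  · rw [← Measure.mapₗ_apply_of_measurable measurable_snd, map_sum]
    have h : ∀ θ, Measure.mapₗ Prod.snd (P θ • ((γ₁ θ).prod ((γ₂ θ).prod (ρ θ))).map (Φ θ)) =
        (μ.prod (μ.prod (P θ • ρ θ))).map S := by
      intro θ
      rw [map_smul, Measure.mapₗ_apply_of_measurable measurable_snd,
        Measure.map_map measurable_snd (hΦ θ), Measure.prod_smul_right, Measure.prod_smul_right,
        Measure.map_smul]
      congr 1
      conv_rhs => rw [← h₁s θ]
      conv_rhs => enter [2, 2, 1]; rw [h₁s θ, ← h₂s θ]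
      conv_rhs => rw [← Measure.map_id (μ := ρ θ)]
      rw [Measure.map_prod_map _ _ measurable_snd measurable_id,
        Measure.map_prod_map _ _ measurable_snd (by fun_prop),
        Measure.map_map hS (by fun_prop)]
      rfl
    simp only [h]
    conv_rhs => rw [← hμ, ← hρ]
    simp only [← Measure.mapₗ_apply_of_measurable hS]
    rw [← map_sum]
    simp only [← Measure.sum_fintype]
    rw [Measure.prod_sum_right, Measure.prod_sum_right]
    exact Measure.mapₗ_apply_of_measurable hS _
  · rw [lintegral_finsetSum_measure, mean, ENNReal.ofReal_sum_of_nonneg]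
    · refine Finset.sum_le_sum fun θ _ => ?_
      rw [lintegral_smul_measure, smul_eq_mul, ENNReal.ofReal_mul ENNReal.toReal_nonneg,
        ENNReal.ofReal_toReal (P.apply_ne_top θ)]
      gcongr
      rw [lintegral_map (by fun_prop) (hΦ θ)]
      have hae : ∀ᵐ z ∂((γ₁ θ).prod ((γ₂ θ).prod (ρ θ))),
          ENNReal.ofReal |((Φ θ z).1 : ℝ) / s - (n : ℝ) ^ 2 * (Φ θ z).2| ≤
            ENNReal.ofReal |(z.1.1 : ℝ) / s - (k θ : ℝ) ^ 2 * z.1.2| +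
            ENNReal.ofReal |(z.2.1.1 : ℝ) / s - (l θ : ℝ) ^ 2 * z.2.1.2| +
            ENNReal.ofReal (A θ) * ENNReal.ofReal |z.1.2| +
            ENNReal.ofReal (B θ) * ENNReal.ofReal |z.2.1.2| + ENNReal.ofReal (C θ) := by
        have hq := (Measure.quasiMeasurePreserving_snd (μ := γ₂ θ) (ν := ρ θ)).comp
          (Measure.quasiMeasurePreserving_snd (μ := γ₁ θ) (ν := (γ₂ θ).prod (ρ θ)))
        filter_upwards [hq.ae (hA θ), hq.ae (hB θ), hq.ae (hC θ)] with z h1 h2 h3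
        rw [← ENNReal.ofReal_mul (hA0 θ), ← ENNReal.ofReal_mul (hB0 θ),
          ← ENNReal.ofReal_add (by positivity) (by positivity),
          ← ENNReal.ofReal_add (by positivity) (mul_nonneg (hA0 θ) (abs_nonneg _)),
          ← ENNReal.ofReal_add (add_nonneg (by positivity) (mul_nonneg (hA0 θ) (abs_nonneg _)))
            (mul_nonneg (hB0 θ) (abs_nonneg _)),
          ← ENNReal.ofReal_add (add_nonneg (add_nonneg (by positivity)
            (mul_nonneg (hA0 θ) (abs_nonneg _))) (mul_nonneg (hB0 θ) (abs_nonneg _))) (hC0 θ)]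
        refine ENNReal.ofReal_le_ofReal ?_
        have := abs_step_le s (T θ) n (k θ) (l θ) z.1.1 z.1.2 z.2.1.1 z.2.1.2 z.2.2 _ _ _ h1 h2 h3
        simpa [Φ, S, toll] using this
      refine (lintegral_mono_ae hae).trans ?_
      have e₁ : ∫⁻ z, ENNReal.ofReal |z.2| ∂(γ₁ θ) ≤ 1 := by
        rw [← h₁s θ, lintegral_map (by fun_prop) measurable_snd] at hμ1
        exact hμ1
      have e₂ : ∫⁻ z, ENNReal.ofReal |z.2| ∂(γ₂ θ) ≤ 1 := by
        rw [← h₂s θ, lintegral_map (by fun_prop) measurable_snd] at hμ1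
        exact hμ1
      rw [lintegral_add_left (by fun_prop), lintegral_add_left (by fun_prop),
        lintegral_add_left (by fun_prop), lintegral_add_left (by fun_prop),
        lintegral_const_mul _ (by fun_prop), lintegral_const_mul _ (by fun_prop),
        lintegral_prod_left _ _ _
          (f := fun w : ℕ × ℝ => ENNReal.ofReal |(w.1 : ℝ) / s - (k θ : ℝ) ^ 2 * w.2|)
          (by fun_prop),
        lintegral_prod_mid _ _ _
          (f := fun w : ℕ × ℝ => ENNReal.ofReal |(w.1 : ℝ) / s - (l θ : ℝ) ^ 2 * w.2|)
          (by fun_prop),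
        lintegral_prod_left _ _ _ (f := fun w : ℕ × ℝ => ENNReal.ofReal |w.2|) (by fun_prop),
        lintegral_prod_mid _ _ _ (f := fun w : ℕ × ℝ => ENNReal.ofReal |w.2|) (by fun_prop),
        lintegral_const, measure_univ, mul_one,
        ENNReal.ofReal_add (add_nonneg (add_nonneg (add_nonneg (hD _) (hD _)) (hA0 θ)) (hB0 θ))
          (hC0 θ),
        ENNReal.ofReal_add (add_nonneg (add_nonneg (hD _) (hD _)) (hA0 θ)) (hB0 θ),
        ENNReal.ofReal_add (add_nonneg (hD _) (hD _)) (hA0 θ), ENNReal.ofReal_add (hD _) (hD _)]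
      gcongr
      · exact h₁c θ
      · exact h₂c θ
      · exact mul_le_of_le_one_right' e₁
      · exact mul_le_of_le_one_right' e₂
    · intro θ _
      exact mul_nonneg ENNReal.toReal_nonneg (add_nonneg (add_nonneg (add_nonneg (add_nonneg
        (hD _) (hD _)) (hA0 θ)) (hB0 θ)) (hC0 θ))

section Wasserstein

theorem wasserstein_le {μ ν : Measure ℝ} {γ : Measure (ℝ × ℝ)} (h1 : γ.map Prod.fst = μ)
    (h2 : γ.map Prod.snd = ν) : wasserstein μ ν ≤ ∫⁻ z, ENNReal.ofReal |z.1 - z.2| ∂γ :=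
  iInf₂_le γ ⟨h1, h2⟩

/-- The easy half of the Kantorovich duality; the constant `L + 1` instead of `L` keeps the factor
positive. -/
theorem ofReal_abs_integral_sub_le {μ ν : Measure ℝ} [IsProbabilityMeasure μ]
    [IsProbabilityMeasure ν] {f : ℝ → ℝ} {L : NNReal} (hf : LipschitzWith L f) {C : ℝ}
    (hC : ∀ x y, dist (f x) (f y) ≤ C) :
    ENNReal.ofReal |∫ x, f x ∂μ - ∫ x, f x ∂ν| ≤ (L + 1) * wasserstein μ ν := by
  have hL0 : (L : ℝ≥0∞) + 1 ≠ 0 := by simp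
  have hLt : (L : ℝ≥0∞) + 1 ≠ ∞ := by simp
  have hmeas : Measurable f := hf.continuous.measurable
  have hbdd : ∀ x, ‖f x‖ ≤ ‖f 0‖ + C := by
    intro x
    have h1 := hC x 0
    rw [dist_eq_norm] at h1
    have h2 := norm_add_le (f x - f 0) (f 0)
    rw [sub_add_cancel] at h2
    linarith
  rw [mul_comm, ← ENNReal.div_le_iff hL0 hLt]
  refine le_iInf₂ fun γ hγ => ?_
  rw [ENNReal.div_le_iff hL0 hLt, mul_comm]
  have hp : IsProbabilityMeasure γ := by
    have : IsProbabilityMeasure (γ.map Prod.fst) := by rw [hγ.1]; infer_instance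
    exact Measure.isProbabilityMeasure_of_map Prod.fst
  have i1 : Integrable (fun z : ℝ × ℝ => f z.1) γ :=
    Integrable.of_bound (hmeas.comp measurable_fst).aestronglyMeasurable (‖f 0‖ + C)
      (Eventually.of_forall fun z => hbdd _)
  have i2 : Integrable (fun z : ℝ × ℝ => f z.2) γ :=
    Integrable.of_bound (hmeas.comp measurable_snd).aestronglyMeasurable (‖f 0‖ + C)
      (Eventually.of_forall fun z => hbdd _)
  have e : ∫ x, f x ∂μ - ∫ x, f x ∂ν = ∫ z, (f z.1 - f z.2) ∂γ := by
    rw [integral_sub i1 i2, ← hγ.1, ← hγ.2, integral_map (by fun_prop) hmeas.aestronglyMeasurable,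
      integral_map (by fun_prop) hmeas.aestronglyMeasurable]
  rw [e, ← Real.enorm_eq_ofReal_abs]
  refine (enorm_integral_le_lintegral_enorm _).trans ?_
  rw [← lintegral_const_mul' _ _ hLt]
  refine lintegral_mono fun z => ?_
  rw [Real.enorm_eq_ofReal_abs]
  calc ENNReal.ofReal |f z.1 - f z.2| ≤ ENNReal.ofReal (L * |z.1 - z.2|) :=
        ENNReal.ofReal_le_ofReal (by simpa [Real.dist_eq] using hf.dist_le_mul z.1 z.2)
    _ = L * ENNReal.ofReal |z.1 - z.2| := by
        rw [ENNReal.ofReal_mul L.coe_nonneg, ENNReal.ofReal_coe_nnreal]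
    _ ≤ (L + 1) * ENNReal.ofReal |z.1 - z.2| := by gcongr; exact le_self_add

/-- Convergence in the Wasserstein metric implies weak convergence. -/
theorem tendsto_of_tendsto_wasserstein {ι : Type*} {F : Filter ι} [F.IsCountablyGenerated]
    {ν : ι → ProbabilityMeasure ℝ} {μ : ProbabilityMeasure ℝ}
    (h : Tendsto (fun i => wasserstein (ν i : Measure ℝ) (μ : Measure ℝ)) F (𝓝 0)) :
    Tendsto ν F (𝓝 μ) := by
  rw [tendsto_iff_forall_lipschitz_integral_tendsto]
  rintro f ⟨C, hC⟩ ⟨L, hf⟩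
  rw [tendsto_iff_dist_tendsto_zero]
  simp only [Real.dist_eq]
  have h1 : Tendsto (fun i => (L + 1) * wasserstein (ν i : Measure ℝ) (μ : Measure ℝ)) F (𝓝 0) := by
    have := ENNReal.Tendsto.const_mul (a := (L : ℝ≥0∞) + 1) h (Or.inr (by simp))
    rwa [mul_zero] at this
  have h2 := tendsto_of_tendsto_of_tendsto_of_le_of_le tendsto_const_nhds h1
    (fun _ => zero_le) fun i => ofReal_abs_integral_sub_le (μ := ν i) (ν := μ) hf hC
  have h3 := (ENNReal.tendsto_toReal ENNReal.zero_ne_top).comp h2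
  rw [ENNReal.toReal_zero] at h3
  exact h3.congr fun i => by simp

/-- The map defined by the limiting equation contracts the cost of a coupling of two solutions by
the factor `2 * E U ^ 2 = 2 / 3`. -/
theorem exists_coupling_contraction {μ ν : Measure ℝ} [IsProbabilityMeasure μ]
    (hμ : SolvesEquation μ) (hν : SolvesEquation ν) {γ : Measure (ℝ × ℝ)}
    (h1 : γ.map Prod.fst = μ) (h2 : γ.map Prod.snd = ν) :
    ∃ γ' : Measure (ℝ × ℝ), γ'.map Prod.fst = μ ∧ γ'.map Prod.snd = ν ∧
      ∫⁻ z, ENNReal.ofReal |z.1 - z.2| ∂γ' ≤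
        ENNReal.ofReal (2 / 3) * ∫⁻ z, ENNReal.ofReal |z.1 - z.2| ∂γ := by
  have hp : IsProbabilityMeasure γ := by
    have : IsProbabilityMeasure (γ.map Prod.fst) := by rw [h1]; infer_instance
    exact Measure.isProbabilityMeasure_of_map Prod.fst
  let S : ℝ × ℝ × ℝ → ℝ := fun z =>
    z.2.2 ^ 2 * z.1 + (1 - z.2.2) ^ 2 * z.2.1 + (z.2.2 ^ 2 + (1 - z.2.2) ^ 2) / 2
  have hS : Measurable S := measurable_limitStep
  let Φ : (ℝ × ℝ) × (ℝ × ℝ) × ℝ → ℝ × ℝ := fun z =>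
    (S (z.1.1, z.2.1.1, z.2.2), S (z.1.2, z.2.1.2, z.2.2))
  have hΦ : Measurable Φ := by fun_prop
  refine ⟨(γ.prod (γ.prod uniform01)).map Φ, ?_, ?_, ?_⟩
  · rw [Measure.map_map measurable_fst hΦ]
    conv_rhs => rw [← hμ, ← h1, ← Measure.map_id (μ := uniform01)]
    rw [Measure.map_prod_map _ _ measurable_fst measurable_id,
      Measure.map_prod_map _ _ measurable_fst (by fun_prop), Measure.map_map hS (by fun_prop)]
    rfl
  · rw [Measure.map_map measurable_snd hΦ]
    conv_rhs => rw [← hν, ← h2, ← Measure.map_id (μ := uniform01)]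
    rw [Measure.map_prod_map _ _ measurable_snd measurable_id,
      Measure.map_prod_map _ _ measurable_snd (by fun_prop), Measure.map_map hS (by fun_prop)]
    rfl
  · rw [lintegral_map (by fun_prop) hΦ]
    let c : ℝ × ℝ → ℝ≥0∞ := fun z => ENNReal.ofReal |z.1 - z.2|
    have hc : Measurable c := by fun_prop
    have hpt : ∀ z, ENNReal.ofReal |(Φ z).1 - (Φ z).2| ≤
        c z.1 * (1 * ENNReal.ofReal (z.2.2 ^ 2)) +
          1 * (c z.2.1 * ENNReal.ofReal ((1 - z.2.2) ^ 2)) := by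
      intro z
      rw [one_mul, one_mul, mul_comm, mul_comm (c z.2.1), ← ENNReal.ofReal_mul (sq_nonneg _),
        ← ENNReal.ofReal_mul (sq_nonneg _), ← ENNReal.ofReal_add (by positivity) (by positivity)]
      refine ENNReal.ofReal_le_ofReal ?_
      have : (Φ z).1 - (Φ z).2 =
          z.2.2 ^ 2 * (z.1.1 - z.1.2) + (1 - z.2.2) ^ 2 * (z.2.1.1 - z.2.1.2) := by
        simp only [Φ, S]; ring
      rw [this]
      refine (abs_add_le _ _).trans (le_of_eq ?_)
      rw [abs_mul, abs_mul, abs_of_nonneg (sq_nonneg z.2.2),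
        abs_of_nonneg (sq_nonneg (1 - z.2.2))]
    refine (lintegral_mono hpt).trans (le_of_eq ?_)
    rw [lintegral_add_left (by fun_prop),
      lintegral_prod_mul_mul γ γ uniform01 hc (measurable_const (a := (1 : ℝ≥0∞)))
        (h := fun u => ENNReal.ofReal (u ^ 2)) (by fun_prop),
      lintegral_prod_mul_mul γ γ uniform01 (measurable_const (a := (1 : ℝ≥0∞))) hc
        (h := fun u => ENNReal.ofReal ((1 - u) ^ 2)) (by fun_prop),
      lintegral_uniform01 (f := fun u => u ^ 2) (by fun_prop) (fun u => sq_nonneg u),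
      lintegral_uniform01 (f := fun u => (1 - u) ^ 2) (by fun_prop) (fun u => sq_nonneg _),
      integral_eq_of_quartic (f := fun u : ℝ => u ^ 2) 0 0 1 0 0 (fun u => by ring),
      integral_eq_of_quartic (f := fun u : ℝ => (1 - u) ^ 2) 1 (-2) 1 0 0 (fun u => by ring)]
    simp only [lintegral_const, measure_univ, one_mul]
    rw [← mul_add, mul_comm, ← ENNReal.ofReal_add (by norm_num) (by norm_num)]
    norm_num [c]

/-- A solution with finite mean is unique: the product coupling has finite cost, and iterating the
contraction makes the cost arbitrarily small. -/
theorem eq_of_solvesEquation {μ ν : ProbabilityMeasure ℝ} (hμ : SolvesEquation (μ : Measure ℝ))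
    (hν : SolvesEquation (ν : Measure ℝ)) (hμ1 : Integrable id (μ : Measure ℝ))
    (hν1 : Integrable id (ν : Measure ℝ)) : ν = μ := by
  have habs : ∀ x : ℝ, ENNReal.ofReal |x| = ‖x‖ₑ := fun x => (Real.enorm_eq_ofReal_abs x).symm
  set c : ℝ≥0∞ := ∫⁻ z : ℝ × ℝ, ENNReal.ofReal |z.1 - z.2| ∂((ν : Measure ℝ).prod (μ : Measure ℝ))
    with hc
  have hct : c ≠ ∞ := by
    have hle : c ≤ ∫⁻ x, ‖x‖ₑ ∂(ν : Measure ℝ) + ∫⁻ x, ‖x‖ₑ ∂(μ : Measure ℝ) := by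
      rw [← (measurePreserving_fst (μ := (ν : Measure ℝ)) (ν := (μ : Measure ℝ))).lintegral_comp
        measurable_enorm, ← (measurePreserving_snd (μ := (ν : Measure ℝ))
        (ν := (μ : Measure ℝ))).lintegral_comp measurable_enorm,
        ← lintegral_add_left (by fun_prop), hc]
      refine lintegral_mono fun z => ?_
      rw [habs]
      exact enorm_sub_le
    exact ne_top_of_le_ne_top (ENNReal.add_ne_top.2 ⟨hν1.2.ne, hμ1.2.ne⟩) hle
  have hk : ∀ k : ℕ, ∃ γ : Measure (ℝ × ℝ), γ.map Prod.fst = (ν : Measure ℝ) ∧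
      γ.map Prod.snd = (μ : Measure ℝ) ∧
      ∫⁻ z, ENNReal.ofReal |z.1 - z.2| ∂γ ≤ ENNReal.ofReal (2 / 3) ^ k * c := by
    intro k
    induction k with
    | zero => exact ⟨(ν : Measure ℝ).prod (μ : Measure ℝ), by simp, by simp, by simp [hc]⟩
    | succ k ih =>
      obtain ⟨γ, h1, h2, h3⟩ := ih
      obtain ⟨γ', h1', h2', h3'⟩ := exists_coupling_contraction hν hμ h1 h2
      refine ⟨γ', h1', h2', h3'.trans ?_⟩
      rw [pow_succ', mul_assoc]
      gcongr
  have hlim : Tendsto (fun k : ℕ => ENNReal.ofReal (2 / 3) ^ k * c) atTop (𝓝 0) := by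
    have h := ENNReal.Tendsto.mul_const (b := c) (ENNReal.tendsto_pow_atTop_nhds_zero_of_lt_one
      (r := ENNReal.ofReal (2 / 3)) (by rw [ENNReal.ofReal_lt_one]; norm_num)) (Or.inr hct)
    rwa [zero_mul] at h
  have hzero : wasserstein (ν : Measure ℝ) (μ : Measure ℝ) = 0 := by
    refine le_antisymm (ge_of_tendsto' hlim fun k => ?_) zero_le
    obtain ⟨γ, h1, h2, h3⟩ := hk k
    exact (wasserstein_le h1 h2).trans h3
  have h := tendsto_of_tendsto_wasserstein (F := (atTop : Filter ℕ)) (ν := fun _ => ν) (μ := μ)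
    (by rw [hzero]; exact tendsto_const_nhds)
  exact tendsto_nhds_unique tendsto_const_nhds h

end Wasserstein

/-! ### Convergence -/

/-- The law of a uniform variable on `[0, 1]` given that it lies in the `a`-th of `n` equal
intervals. -/
def cell {n : ℕ} (a : Fin n) : Measure ℝ :=
  (n : ℝ≥0∞) • volume.restrict (Set.Ico ((a : ℕ) / n : ℝ) (((a : ℕ) + 1 : ℝ) / n))

instance {n : ℕ} (a : Fin n) : IsProbabilityMeasure (cell a) := by
  have hn : (0 : ℝ) < n := by exact_mod_cast a.pos
  constructor
  rw [cell, Measure.smul_apply, Measure.restrict_apply_univ, Real.volume_Ico, ← sub_div,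
    add_sub_cancel_left, smul_eq_mul, ← ENNReal.ofReal_natCast n,
    ← ENNReal.ofReal_mul hn.le, mul_one_div_cancel hn.ne', ENNReal.ofReal_one]

theorem ae_cell {n : ℕ} (a : Fin n) :
    ∀ᵐ u ∂cell a, ((a : ℕ) : ℝ) ≤ n * u ∧ n * u ≤ ((a : ℕ) : ℝ) + 1 := by
  have hn : (0 : ℝ) < n := by exact_mod_cast a.pos
  refine Measure.ae_smul_measure ?_ _
  filter_upwards [ae_restrict_mem measurableSet_Ico] with u hu
  rw [Set.mem_Ico, div_le_iff₀ hn, lt_div_iff₀ hn] at hu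
  constructor <;> linarith

theorem sum_restrict_Ico (n k : ℕ) :
    ∑ a ∈ Finset.range k, volume.restrict (Set.Ico ((a : ℝ) / n) (((a : ℝ) + 1) / n)) =
      volume.restrict (Set.Ico (0 : ℝ) ((k : ℝ) / n)) := by
  induction k with
  | zero => simp
  | succ k ih =>
    rw [Finset.sum_range_succ, ih, ← Measure.restrict_union _ measurableSet_Ico,
      Set.Ico_union_Ico_eq_Ico (by positivity) (by gcongr; linarith), Nat.cast_succ]
    exact Set.Ico_disjoint_Ico_same

theorem sum_cell (n : ℕ) [NeZero n] : ∑ a : Fin n, (n : ℝ≥0∞)⁻¹ • cell a = uniform01 := by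
  have hn : (n : ℝ≥0∞) ≠ 0 := by exact_mod_cast NeZero.ne n
  have hn' : (n : ℝ) ≠ 0 := by exact_mod_cast NeZero.ne n
  simp only [cell, smul_smul, ENNReal.inv_mul_cancel hn (ENNReal.natCast_ne_top n), one_smul]
  rw [Fin.sum_univ_eq_sum_range
    (fun a => volume.restrict (Set.Ico ((a : ℝ) / n) (((a : ℝ) + 1) / n))), sum_restrict_Ico,
    div_self hn', uniform01]
  exact Measure.restrict_congr_set Ico_ae_eq_Icc

/-- The joint law of the pivot and the errors. -/
def stageLaw (n : ℕ) [NeZero n] (p : unitInterval) : PMF (Fin n × (Fin n → Bool)) :=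
  (PMF.uniformOfFintype (Fin n)).bind fun a => (coins (Fin n) p).map fun e => (a, e)

theorem stageLaw_apply (n : ℕ) [NeZero n] (p : unitInterval) (a : Fin n) (e : Fin n → Bool) :
    stageLaw n p (a, e) = (n : ℝ≥0∞)⁻¹ * coins (Fin n) p e := by
  rw [stageLaw, PMF.bind_apply, tsum_eq_single a, PMF.map_apply, tsum_eq_single e]
  · simp
  · intro e' he
    rw [if_neg]
    intro h
    exact he (Prod.ext_iff.1 h).2.symm
  · intro a' ha
    rw [PMF.map_apply, ENNReal.tsum_eq_zero.2, mul_zero]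
    intro e'
    rw [if_neg]
    intro h
    exact ha (Prod.ext_iff.1 h).1.symm

theorem mean_stageLaw (n : ℕ) [NeZero n] (p : unitInterval) (f : Fin n × (Fin n → Bool) → ℝ) :
    mean (stageLaw n p) f =
      mean (PMF.uniformOfFintype (Fin n)) fun a => mean (coins (Fin n) p) fun e => f (a, e) := by
  rw [stageLaw, mean_bind]
  simp only [mean_map]

theorem sum_stageLaw_cell (n : ℕ) [NeZero n] (p : unitInterval) :
    ∑ θ, stageLaw n p θ • cell θ.1 = uniform01 := by
  rw [← sum_cell n, Fintype.sum_prod_type]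
  refine Finset.sum_congr rfl fun a _ => ?_
  simp only [stageLaw_apply, ← Finset.sum_smul, ← Finset.mul_sum]
  rw [← tsum_fintype (L := .unconditional _), PMF.tsum_coe, mul_one]

theorem abs_sq_sub_sq_le {x y n c : ℝ} (hx : 0 ≤ x) (hy : 0 ≤ y) (hxn : x ≤ n) (hyn : y ≤ n)
    (h : |x - y| ≤ c) : |x ^ 2 - y ^ 2| ≤ 2 * n * c := by
  rw [sq_sub_sq, abs_mul, abs_of_nonneg (by linarith : 0 ≤ x + y)]
  have : 0 ≤ |x - y| := abs_nonneg _
  exact mul_le_mul (by linarith) h this (by linarith)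

/-- One step of the induction: `α * n ^ 2 + β * n` reproduces itself, if the error of a stage is at
most `α / 4 * n ^ 2` in the mean. The quadratic part leaves room for the error because the
squares of the sizes of the two sublists add up to at most `3 / 4 * n ^ 2` in the mean. -/
theorem hasCoupling_of_mean_stageError_le {μ : Measure ℝ} [IsProbabilityMeasure μ]
    (hμ : SolvesEquation μ) (hμ1 : ∫⁻ x, ENNReal.ofReal |x| ∂μ ≤ 1) (p : unitInterval)
    (hp : (p : ℝ) ≤ 1 / 48) {α β : ℝ} (hα : 0 ≤ α) (hβ : 0 ≤ β) (m : ℕ)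
    (hm : ∀ k ≤ m, HasCoupling μ p (inversionLaw k p) k (α * k ^ 2 + β * k))
    (herr : ∀ a : Fin (m + 1), mean (coins (Fin (m + 1)) p) (stageError p a) ≤
      α / 4 * ((m + 1 : ℕ) : ℝ) ^ 2) :
    HasCoupling μ p (inversionLaw (m + 1) p) (m + 1)
      (α * ((m + 1 : ℕ) : ℝ) ^ 2 + β * (m + 1 : ℕ)) := by
  set n := m + 1 with hn
  have hN : ∀ (a : Fin n) e, 0 ≤ numErr e := fun a e =>
    (abs_nonneg _).trans (abs_card_leftSet_sub_le a e)
  have hsize : ∀ θ : Fin n × (Fin n → Bool),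
      ((leftSet θ.1 θ.2).card : ℝ) + (rightSet θ.1 θ.2).card + 1 = n := fun θ => by
    exact_mod_cast card_leftSet_add_card_rightSet θ.1 θ.2
  have hsize' : ∀ θ : Fin n × (Fin n → Bool),
      (leftSet θ.1 θ.2).card + (rightSet θ.1 θ.2).card = m := fun θ => by
    have := card_leftSet_add_card_rightSet θ.1 θ.2; omega
  have key := hasCoupling_step hμ hμ1 (stageLaw n p) (fun θ => (leftSet θ.1 θ.2).card)
    (fun θ => (rightSet θ.1 θ.2).card) (fun θ => stageCost θ.1 θ.2) (fun θ => cell θ.1)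
    (sum_stageLaw_cell n p) (fun k => inversionLaw k p) n
    ((inversionLaw_succ m p).trans (by
      rw [stageLaw, PMF.bind_bind]
      simp only [PMF.bind_map]
      rfl))
    (s := p) (D := fun k => α * k ^ 2 + β * k) (fun k => by positivity)
    (fun θ => hm _ (by have := hsize' θ; omega)) (fun θ => hm _ (by have := hsize' θ; omega))
    (A := fun θ => 2 * n * (numErr θ.2 + 1)) (B := fun θ => 2 * n * (numErr θ.2 + 2))
    (C := fun θ => |(stageCost θ.1 θ.2 : ℝ) / p -
      (((θ.1 : ℕ) : ℝ) ^ 2 + ((n : ℝ) - (θ.1 : ℕ)) ^ 2) / 2| + 2 * n)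
    (fun θ => by have := hN θ.1 θ.2; positivity) (fun θ => by have := hN θ.1 θ.2; positivity)
    (fun θ => by positivity) ?_ ?_ ?_
  · refine key.mono ?_
    have hpt : ∀ θ : Fin n × (Fin n → Bool),
        α * ((leftSet θ.1 θ.2).card : ℝ) ^ 2 + β * (leftSet θ.1 θ.2).card +
        (α * ((rightSet θ.1 θ.2).card : ℝ) ^ 2 + β * (rightSet θ.1 θ.2).card) +
        2 * n * (numErr θ.2 + 1) + 2 * n * (numErr θ.2 + 2) +
        (|(stageCost θ.1 θ.2 : ℝ) / p -
          (((θ.1 : ℕ) : ℝ) ^ 2 + ((n : ℝ) - (θ.1 : ℕ)) ^ 2) / 2| + 2 * n) =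
        α * (((leftSet θ.1 θ.2).card : ℝ) ^ 2 + ((rightSet θ.1 θ.2).card : ℝ) ^ 2) +
          (stageError p θ.1 θ.2 + β * (n - 1)) := by
      intro θ
      have : ((leftSet θ.1 θ.2).card : ℝ) + (rightSet θ.1 θ.2).card = n - 1 := by
        linarith [hsize θ]
      rw [stageError, ← this]
      ring
    simp only [hpt, mean_add, mean_const_mul, mean_const]
    have h1 : mean (stageLaw n p) (fun θ => ((leftSet θ.1 θ.2).card : ℝ) ^ 2 +
        ((rightSet θ.1 θ.2).card : ℝ) ^ 2) ≤ 3 / 4 * (n : ℝ) ^ 2 := by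
      rw [mean_stageLaw]
      refine (mean_card_sq_le m p).trans ?_
      gcongr
      linarith
    have h2 : mean (stageLaw n p) (fun θ => stageError p θ.1 θ.2) ≤ α / 4 * (n : ℝ) ^ 2 := by
      rw [mean_stageLaw]
      refine (mean_mono _ (g := fun _ => α / 4 * (n : ℝ) ^ 2) herr).trans (le_of_eq ?_)
      rw [mean_const]
    have h1' := mul_le_mul_of_nonneg_left h1 hα
    simp only [mean_add] at h1'
    nlinarith
  · intro θ
    filter_upwards [ae_cell θ.1] with u hu
    have ha : ((θ.1 : ℕ) : ℝ) + 1 ≤ n := by exact_mod_cast θ.1.2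
    have ha0 : (0 : ℝ) ≤ ((θ.1 : ℕ) : ℝ) := Nat.cast_nonneg _
    have hr : (0 : ℝ) ≤ (rightSet θ.1 θ.2).card := Nat.cast_nonneg _
    rw [← mul_pow]
    refine abs_sq_sub_sq_le (Nat.cast_nonneg _) (by linarith) (by linarith [hsize θ])
      (by linarith) ?_
    have h1 := abs_le.1 (abs_card_leftSet_sub_le θ.1 θ.2)
    rw [abs_le]
    constructor <;> linarith
  · intro θ
    filter_upwards [ae_cell θ.1] with u hu
    have ha : ((θ.1 : ℕ) : ℝ) + 1 ≤ n := by exact_mod_cast θ.1.2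
    have ha0 : (0 : ℝ) ≤ ((θ.1 : ℕ) : ℝ) := Nat.cast_nonneg _
    have hl : (0 : ℝ) ≤ (leftSet θ.1 θ.2).card := Nat.cast_nonneg _
    rw [← mul_pow]
    refine abs_sq_sub_sq_le (Nat.cast_nonneg _) (by linarith) (by linarith [hsize θ])
      (by linarith) ?_
    have h1 := abs_le.1 (abs_card_leftSet_sub_le θ.1 θ.2)
    have h2 := hsize θ
    rw [abs_le]
    constructor <;> linarith
  · intro θ
    filter_upwards [ae_cell θ.1] with u hu
    have ha : ((θ.1 : ℕ) : ℝ) + 1 ≤ n := by exact_mod_cast θ.1.2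
    have ha0 : (0 : ℝ) ≤ ((θ.1 : ℕ) : ℝ) := Nat.cast_nonneg _
    have h1 : |((θ.1 : ℕ) : ℝ) ^ 2 - (n * u) ^ 2| ≤ 2 * n * 1 :=
      abs_sq_sub_sq_le ha0 (by linarith) (by linarith) (by linarith)
        (by rw [abs_le]; constructor <;> linarith)
    have h2 : |((n : ℝ) - (θ.1 : ℕ)) ^ 2 - (n - n * u) ^ 2| ≤ 2 * n * 1 :=
      abs_sq_sub_sq_le (by linarith) (by linarith) (by linarith) (by linarith)
        (by rw [abs_le]; constructor <;> linarith)
    have h3 : (stageCost θ.1 θ.2 : ℝ) / p - (n : ℝ) ^ 2 * toll u =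
        ((stageCost θ.1 θ.2 : ℝ) / p - (((θ.1 : ℕ) : ℝ) ^ 2 + ((n : ℝ) - (θ.1 : ℕ)) ^ 2) / 2) +
        ((((θ.1 : ℕ) : ℝ) ^ 2 - (n * u) ^ 2) / 2 +
          (((n : ℝ) - (θ.1 : ℕ)) ^ 2 - (n - n * u) ^ 2) / 2) := by
      rw [toll]; ring
    rw [h3]
    refine (abs_add_le _ _).trans (add_le_add le_rfl ?_)
    refine (abs_add_le _ _).trans ?_
    rw [abs_div, abs_div, abs_two]
    linarith

theorem inversionLaw_zero (p : unitInterval) : inversionLaw 0 p = PMF.pure 0 := by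
  have h : ∀ σ : Equiv.Perm (Fin 0), (quicksort p (List.ofFn σ)).map inversions = PMF.pure 0 :=
    fun σ => by rw [List.ofFn_zero]; exact inversionLawOf_nil p
  rw [inversionLaw]
  simp only [h, PMF.bind_const]

theorem hasCoupling_zero (μ : Measure ℝ) [IsProbabilityMeasure μ] (p : unitInterval) (c : ℝ) :
    HasCoupling μ p (inversionLaw 0 p) 0 c := by
  refine ⟨(inversionLaw 0 p).toMeasure.prod μ, by simp, by simp, ?_⟩
  rw [inversionLaw_zero, PMF.toMeasure_pure, Measure.dirac_prod, lintegral_map (by fun_prop)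
    (by fun_prop)]
  simp

/-- A bound of the right order for all `n`, which covers the lists too short for the law of large
numbers. -/
theorem hasCoupling_crude {μ : Measure ℝ} [IsProbabilityMeasure μ]
    (hμ : SolvesEquation μ) (hμ1 : ∫⁻ x, ENNReal.ofReal |x| ∂μ ≤ 1) (p : unitInterval)
    (hp0 : 0 < (p : ℝ)) (hp : (p : ℝ) ≤ 1 / 48) (n : ℕ) :
    HasCoupling μ p (inversionLaw n p) n (60 * (n : ℝ) ^ 2) := by
  have h : ∀ n : ℕ, HasCoupling μ p (inversionLaw n p) n (60 * (n : ℝ) ^ 2 + 0 * n) := by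
    intro n
    induction n using Nat.strong_induction_on with
    | _ n ih =>
      cases n with
      | zero => exact hasCoupling_zero μ p _
      | succ m =>
        refine hasCoupling_of_mean_stageError_le hμ hμ1 p hp (by norm_num) le_rfl m
          (fun k hk => ih k (by omega)) fun a => (mean_stageError_le_crude p a hp0).trans ?_
        rw [show (60 : ℝ) / 4 = 15 by norm_num]
  exact (h n).mono (by linarith)

/-- Below the size `1 / (δ ^ 2 * p)` the crude bound is absorbed by the linear term, above it the
error of a stage is small. -/
theorem hasCoupling_fine {μ : Measure ℝ} [IsProbabilityMeasure μ]
    (hμ : SolvesEquation μ) (hμ1 : ∫⁻ x, ENNReal.ofReal |x| ∂μ ≤ 1) (p : unitInterval)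
    (hp0 : 0 < (p : ℝ)) (hp : (p : ℝ) ≤ 1 / 48) {δ : ℝ} (hδ : 0 < δ) (hδ1 : δ ≤ 1) (n : ℕ) :
    HasCoupling μ p (inversionLaw n p) n
      (4 * (15 * p + δ) * (n : ℝ) ^ 2 + 60 / (δ ^ 2 * p) * n) := by
  induction n using Nat.strong_induction_on with
  | _ n ih =>
    rcases le_total 1 (n * (δ ^ 2 * p)) with h | h
    · cases n with
      | zero => exact hasCoupling_zero μ p _
      | succ m =>
        refine hasCoupling_of_mean_stageError_le hμ hμ1 p hp (by positivity) (by positivity) m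
          (fun k hk => ih k (by omega)) fun a => (mean_stageError_le p a hp0 hδ hδ1 h).trans ?_
        rw [mul_div_cancel_left₀ _ (by norm_num : (4 : ℝ) ≠ 0)]
    · refine (hasCoupling_crude hμ hμ1 p hp0 hp n).mono ?_
      have h1 : (n : ℝ) ≤ 1 / (δ ^ 2 * p) := by rwa [le_div_iff₀ (by positivity)]
      have h2 : 60 * (n : ℝ) ^ 2 ≤ 60 / (δ ^ 2 * p) * n := by
        have : 60 / (δ ^ 2 * (p : ℝ)) = 60 * (1 / (δ ^ 2 * p)) := by ring
        rw [this]
        nlinarith [mul_le_mul_of_nonneg_right h1 (Nat.cast_nonneg (α := ℝ) n)]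
      have h3 : 0 ≤ 4 * (15 * p + δ) * (n : ℝ) ^ 2 := by positivity
      linarith

/-- The rate of convergence, with a free parameter `δ`. -/
theorem wasserstein_normalizedLaw_le {μ : Measure ℝ} [IsProbabilityMeasure μ]
    (hμ : SolvesEquation μ) (hμ1 : ∫⁻ x, ENNReal.ofReal |x| ∂μ ≤ 1) {n : ℕ} (hn : 0 < n)
    (p : unitInterval) (hp0 : 0 < (p : ℝ)) (hp : (p : ℝ) ≤ 1 / 48) {δ : ℝ} (hδ : 0 < δ)
    (hδ1 : δ ≤ 1) : wasserstein (normalizedLaw n p : Measure ℝ) μ ≤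
      ENNReal.ofReal (4 * (15 * p + δ) + 60 / (δ ^ 2 * (n * p))) := by
  obtain ⟨γ, h1, h2, h3⟩ := hasCoupling_fine hμ hμ1 p hp0 hp hδ hδ1 n
  have hn0 : (0 : ℝ) < n := by exact_mod_cast hn
  let Φ : ℕ × ℝ → ℝ × ℝ := fun z => ((z.1 : ℝ) / ((n : ℝ) ^ 2 * (p : ℝ)), z.2)
  have hΦ : Measurable Φ := by fun_prop
  have hf : Measurable fun k : ℕ => (k : ℝ) / ((n : ℝ) ^ 2 * (p : ℝ)) := measurable_of_countable _
  refine (wasserstein_le (γ := γ.map Φ) ?_ ?_).trans ?_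
  · rw [normalizedLaw, ProbabilityMeasure.coe_mk, ← PMF.toMeasure_map _ _ hf, ← h1,
      Measure.map_map hf measurable_fst, Measure.map_map measurable_fst hΦ]
    rfl
  · rw [Measure.map_map measurable_snd hΦ, ← h2]
    rfl
  · rw [lintegral_map (by fun_prop) hΦ]
    have hpt : ∀ z : ℕ × ℝ, ENNReal.ofReal |(Φ z).1 - (Φ z).2| =
        ENNReal.ofReal (1 / (n : ℝ) ^ 2) *
          ENNReal.ofReal |(z.1 : ℝ) / p - (n : ℝ) ^ 2 * z.2| := by
      intro z
      rw [← ENNReal.ofReal_mul (by positivity)]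
      congr 1
      rw [← abs_of_pos (by positivity : (0 : ℝ) < 1 / (n : ℝ) ^ 2), ← abs_mul]
      congr 1
      simp only [Φ]
      field_simp
    simp only [hpt]
    rw [lintegral_const_mul _ (by fun_prop)]
    refine (mul_le_mul_right h3 _).trans (le_of_eq ?_)
    rw [← ENNReal.ofReal_mul (by positivity)]
    congr 1
    field_simp

theorem tendsto_wasserstein {μ : Measure ℝ} [IsProbabilityMeasure μ]
    (hμ : SolvesEquation μ) (hμ1 : ∫⁻ x, ENNReal.ofReal |x| ∂μ ≤ 1) :
    Tendsto (fun x : ℕ × unitInterval => wasserstein (normalizedLaw x.1 x.2 : Measure ℝ) μ)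
      slowFilter (𝓝 0) := by
  rw [ENNReal.tendsto_nhds_zero]
  intro ε hε
  obtain ⟨η, hη, hηε⟩ : ∃ η : ℝ, 0 < η ∧ ENNReal.ofReal η ≤ ε := by
    obtain ⟨r, hr, hrε⟩ := ENNReal.lt_iff_exists_nnreal_btwn.1 hε
    exact ⟨r, by exact_mod_cast hr, by rw [ENNReal.ofReal_coe_nnreal]; exact hrε.le⟩
  set δ : ℝ := min 1 (η / 12) with hδdef
  have hδ : 0 < δ := by positivity
  have hp : ∀ᶠ x : ℕ × unitInterval in slowFilter, (x.2 : ℝ) < min (1 / 48) (η / 180) := by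
    have : ∀ᶠ r : ℝ in 𝓝 0, r < min (1 / 48) (η / 180) := eventually_lt_nhds (by positivity)
    exact (this.comap _).filter_mono inf_le_left
  have hnp : ∀ᶠ x : ℕ × unitInterval in slowFilter,
      max 1 (180 / (δ ^ 2 * η)) ≤ (x.1 : ℝ) * (x.2 : ℝ) :=
    ((eventually_ge_atTop _).comap _).filter_mono inf_le_right
  filter_upwards [hp, hnp] with x h1 h2
  have hp0 : 0 ≤ (x.2 : ℝ) := x.2.2.1
  have h3 : 1 ≤ (x.1 : ℝ) * (x.2 : ℝ) := (le_max_left _ _).trans h2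
  have hp0' : 0 < (x.2 : ℝ) := by
    rcases hp0.eq_or_lt with h | h
    · rw [← h] at h3; norm_num at h3
    · exact h
  have hn : 0 < x.1 := by
    rcases Nat.eq_zero_or_pos x.1 with h | h
    · rw [h] at h3; norm_num at h3
    · exact h
  refine (wasserstein_normalizedLaw_le hμ hμ1 hn x.2 hp0' (h1.le.trans (min_le_left _ _)) hδ
    (min_le_left _ _)).trans ((ENNReal.ofReal_le_ofReal ?_).trans hηε)
  have h4 : (x.2 : ℝ) ≤ η / 180 := h1.le.trans (min_le_right _ _)
  have h5 : δ ≤ η / 12 := min_le_right _ _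
  have h6 : 60 / (δ ^ 2 * ((x.1 : ℝ) * (x.2 : ℝ))) ≤ η / 3 := by
    have h7 : 180 / (δ ^ 2 * η) ≤ (x.1 : ℝ) * (x.2 : ℝ) := (le_max_right _ _).trans h2
    rw [div_le_iff₀ (by positivity)] at h7 ⊢
    linarith
  linarith

instance : slowFilter.IsCountablyGenerated := by unfold slowFilter; infer_instance

end NoisyQuicksort

end

theorem theorem2 :
    ∃ μ : ProbabilityMeasure ℝ,
      -- `μ` is the unique law with finite mean that solves the distributional equation
      Integrable id (μ : Measure ℝ) ∧
      NoisyQuicksort.SolvesEquation (μ : Measure ℝ) ∧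
      (∀ ν : ProbabilityMeasure ℝ, Integrable id (ν : Measure ℝ) →
        NoisyQuicksort.SolvesEquation (ν : Measure ℝ) → ν = μ) ∧
      -- convergence in distribution
      Tendsto (fun x : ℕ × unitInterval => NoisyQuicksort.normalizedLaw x.1 x.2)
        NoisyQuicksort.slowFilter (𝓝 μ) ∧
      -- convergence in the Wasserstein metric
      Tendsto (fun x : ℕ × unitInterval =>
          NoisyQuicksort.wasserstein (NoisyQuicksort.normalizedLaw x.1 x.2 : Measure ℝ)
            (μ : Measure ℝ))
        NoisyQuicksort.slowFilter (𝓝 0) ∧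
      -- mean and variance
      ∫ x, x ∂(μ : Measure ℝ) = 1 ∧
      MemLp id 2 (μ : Measure ℝ) ∧
      variance id (μ : Measure ℝ) = 1 / 12 := by
  obtain ⟨μ, hμ, hμ1, hL2⟩ := NoisyQuicksort.exists_solution
  have hint : Integrable id (μ : Measure ℝ) := hL2.integrable one_le_two
  have hW := NoisyQuicksort.tendsto_wasserstein hμ hμ1
  exact ⟨μ, hint, hμ, fun ν hν1 hν => NoisyQuicksort.eq_of_solvesEquation hμ hν hint hν1,
    NoisyQuicksort.tendsto_of_tendsto_wasserstein hW, hW, NoisyQuicksort.mean_eq_one hμ hint, hL2,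
    NoisyQuicksort.variance_eq hμ hL2⟩
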